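/- \textbf{Definitions.} Write $\{0,1\}^n$ for the Boolean cube and $N=2^n$. For $f,g:\{0,1\}^n\to\{-1,1\}$ let $$\Phi_{f,g}=\frac{1}{2^{3n/2}}\sum_{x,y\in\{0,1\}^n} f(x)\,(-1)^{x\cdot y}\,g(y).$$ The partial Boolean function $\mathsf{For}_n$ takes as input the $2N$ bits of the truth tables of $f$ and $g$ (a value $s\in\{-1,1\}$ being encoded by the bit $(1+s)/2$). It equals $1$ if $\Phi_{f,g}\ge 0.07$, equals $0$ if $|\Phi_{f,g}|\le 0.01$, and is undefined otherwise. A $\mathsf{BPP_{path}}$ query algorithm $A$ on $M$-bit inputs is a randomized query algorithm, that is, a probability distribution over deterministic decision trees that adaptively query bits of the input $z\in\{0,1\}^M$, in which every run ends by failing, accepting or rejecting; the run succeeds if it accepts or rejects. It makes at most $q$ queries if each decision tree in the support of the distribution has depth at most $q$. It computes a partial function $F:D\to\{0,1\}$, $D\subseteq\{0,1\}^M$, if for every $z\in D$: (i) $\Pr[A(z)\text{ succeeds}]>0$; (ii) if $F(z)=1$ then $\Pr[A(z)\text{ accepts}\mid A(z)\text{ succeeds}]\ge \frac23$; (iii)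 if $F(z)=0$ then $\Pr[A(z)\text{ accepts}\mid A(z)\text{ succeeds}]\le\frac13$. \textbf{Theorem.} No $\mathsf{BPP_{path}}$ query algorithm computes $\mathsf{For}_n$ with $\operatorname{poly}(n)$ queries. Precisely: for every polynomial $p$ with coefficients in $\mathbb{N}$ there is an $n_0$ such that for all $n\ge n_0$ there is no $\mathsf{BPP_{path}}$ query algorithm that makes at most $p(n)$ queries and computes $\mathsf{For}_n$. -/

import Mathlib

open scoped ENNReal

/-- The result of a run: fail, or succeed and then either accept or reject. -/
inductive PathOutcome where
  | fail : PathOutcome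
  | accept : PathOutcome
  | reject : PathOutcome

/-- Deterministic (adaptive) query algorithms on inputs `z : ι → Bool`, i.e. decision trees.
`query i t₀ t₁` reads the bit `z i` and continues with `t₀` if it is `false`, and with `t₁` if it
is `true`. -/
inductive QueryTree (ι : Type) where
  | leaf : PathOutcome → QueryTree ι
  | query : ι → QueryTree ι → QueryTree ι → QueryTree ι

namespace QueryTree

variable {ι : Type}

/-- The outcome of the tree on the input `z`. -/
def run (z : ι → Bool) : QueryTree ι → PathOutcome
  | leaf o => o
  | query i t₀ t₁ => if z i then run z t₁ else run z t₀

/-- The worst-case number of queries. -/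
def depth : QueryTree ι → ℕ
  | leaf _ => 0
  | query _ t₀ t₁ => max (depth t₀) (depth t₁) + 1

end QueryTree

/-- A `BPP_path` query algorithm: a randomized query algorithm (a probability distribution on
deterministic ones) whose runs fail, accept or reject. -/
abbrev BPPPathAlgorithm (ι : Type) := PMF (QueryTree ι)

namespace BPPPathAlgorithm

variable {ι : Type}

/-- Every run, whatever the coin flips and the input, makes at most `q` queries. -/
def MakesAtMost (A : BPPPathAlgorithm ι) (q : ℕ) : Prop :=
  ∀ t ∈ A.support, t.depth ≤ q

/-- The probability that `A` has outcome `o` on the input `z`. -/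
noncomputable def prob (A : BPPPathAlgorithm ι) (z : ι → Bool) (o : PathOutcome) : ℝ≥0∞ :=
  A.map (QueryTree.run z) o

/-- `Pr[A(z) succeeds]`. -/
noncomputable def succeedProb (A : BPPPathAlgorithm ι) (z : ι → Bool) : ℝ≥0∞ :=
  A.prob z .accept + A.prob z .reject

/-- `Pr[A(z) accepts | A(z) succeeds]`, meaningful when `Pr[A(z) succeeds] > 0`. -/
noncomputable def acceptProbGivenSucceed (A : BPPPathAlgorithm ι) (z : ι → Bool) : ℝ≥0∞ :=
  A.prob z .accept / A.succeedProb z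

/-- `A` computes the partial Boolean function `F` (`F z = none` outside the domain of `F`). Nothing
is required of `A` on inputs outside the domain. -/
def Computes (A : BPPPathAlgorithm ι) (F : (ι → Bool) → Option Bool) : Prop :=
  (∀ z, F z ≠ none → 0 < A.succeedProb z) ∧
  (∀ z, F z = some true → 2 / 3 ≤ A.acceptProbGivenSucceed z) ∧
  (∀ z, F z = some false → A.acceptProbGivenSucceed z ≤ 1 / 3)

end BPPPathAlgorithm

/-- `Φ_{f,g} = 2^{-3n/2} ∑_{x,y} f(x) (-1)^{x·y} g(y)`. -/
noncomputable def forrelation (n : ℕ) (f g : (Fin n → Bool) → ℤˣ) : ℝ :=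
  1 / (2 : ℝ) ^ (3 * (n : ℝ) / 2) *
    ∑ x : Fin n → Bool, ∑ y : Fin n → Bool,
      ((f x : ℤ) : ℝ) * (-1) ^ (∑ i, (x i).toNat * (y i).toNat) * ((g y : ℤ) : ℝ)

/-- The identification of `{0,1}` with `{-1,1}` inverse to `s ↦ (1 + s) / 2`. -/
def bitSign (b : Bool) : ℤˣ := if b then 1 else -1

/-- The positions of the `2 · 2^n` input bits of `For_n`: the truth table of `f` followed by the
truth table of `g`. -/
abbrev ForIndex (n : ℕ) := (Fin n → Bool) ⊕ (Fin n → Bool)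

/-- The partial function `For_n`. -/
noncomputable def For (n : ℕ) (z : ForIndex n → Bool) : Option Bool :=
  let Φ := forrelation n (fun x => bitSign (z (.inl x))) (fun y => bitSign (z (.inr y)))
  if 0.07 ≤ Φ then some true
  else if |Φ| ≤ 0.01 then some false
  else none

/-!
Two measures on the inputs of `For n` are compared on subcubes. The first is the uniform measure
restricted to the inputs with `|Φ| ≤ 0.01`. The second is the law of the signs of `(v, Hᵀ v)`, where
`v` is a standard Gaussian vector and `H` the normalised Hadamard matrix, restricted to the inputs
with `Φ ≥ 0.07`. Writing `f` and `g` for the signs of `v` and `Hᵀ v`, orthogonality of `H` gives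
`N (1 - Φ) ≤ ‖f - c v‖² + ‖g - c Hᵀ v‖²` for every `c`. A second moment bound for the right side at
`c = 4 / 5` shows that `Φ < 0.07` has conditional probability at most about `0.69` on each subcube.

Any `q` rows of `(1, Hᵀ)` are nearly orthonormal, so their joint Gaussian density is within a factor
close to `1` of an isotropic one, whose signs are uniform. Hence both restricted measures give each
subcube of codimension `k ≤ q` a mass between `a * 2⁻ᵏ` and `b * 2⁻ᵏ`, where the product of the two
quotients `b / a` is less than `4`. A `BPP_path` algorithm, however, needs the quotient of its
acceptance and rejection probabilities to grow from at most `1 / 2` to at least `2`.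
-/

open MeasureTheory ProbabilityTheory Matrix
open scoped NNReal

/-- The subcube of inputs that agree with `s` on the coordinates in `K`; its codimension is
`K.card`. -/
def subcube {ι : Type*} (K : Finset ι) (s : ι → Bool) : Set (ι → Bool) :=
  {z | ∀ i ∈ K, z i = s i}

section Subcube

variable {ι : Type*}

instance (K : Finset ι) (s : ι → Bool) : DecidablePred (· ∈ subcube K s) := fun z =>
  inferInstanceAs (Decidable (∀ i ∈ K, z i = s i))

@[simp]
theorem mem_subcube {K : Finset ι} {s z : ι → Bool} : z ∈ subcube K s ↔ ∀ i ∈ K, z i = s i :=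
  Iff.rfl

@[simp]
theorem subcube_empty (s : ι → Bool) : subcube ∅ s = Set.univ := by
  simp [subcube]

theorem measurableSet_subcube (K : Finset ι) (s : ι → Bool) : MeasurableSet (subcube K s) := by
  have h : subcube K s = ⋂ i ∈ K, (fun z : ι → Bool => z i) ⁻¹' {s i} := by
    ext z
    simp [subcube]
  rw [h]
  exact K.measurableSet_biInter fun i _ => measurable_pi_apply i (measurableSet_singleton _)

theorem subcube_inter_eq_or [DecidableEq ι] (K : Finset ι) (s : ι → Bool) (i : ι) (b : Bool) :
    subcube K s ∩ {z | z i = b} = ∅ ∨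
      subcube K s ∩ {z | z i = b} = subcube (insert i K) (Function.update s i b) := by
  by_cases h : i ∈ K ∧ s i ≠ b
  · left
    ext z
    simp only [subcube, Set.mem_inter_iff, Set.mem_ofPred_eq, Set.mem_empty_iff_false, iff_false]
    exact fun hz => h.2 (hz.1 i h.1 ▸ hz.2)
  · right
    ext z
    simp only [subcube, Set.mem_inter_iff, Set.mem_ofPred_eq, Function.update_apply]
    grind

theorem measurableSet_setOf_apply_eq (i : ι) (b : Bool) :
    MeasurableSet {z : ι → Bool | z i = b} :=
  measurableSet_eq_fun (measurable_pi_apply i) measurable_const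

/-- Domination of `μ` by `ν` on all subcubes of codimension at most `q`. -/
def SubcubeLE (q : ℕ) (μ ν : Measure (ι → Bool)) : Prop :=
  ∀ (K : Finset ι) (s : ι → Bool), K.card ≤ q → μ (subcube K s) ≤ ν (subcube K s)

/-- Almost `q`-wise uniformity: the measure of every subcube of codimension `k ≤ q` lies between
`a * 2⁻ᵏ` and `b * 2⁻ᵏ`. -/
def IsAlmostUniform (q : ℕ) (a b : ℝ≥0) (μ : Measure (ι → Bool)) : Prop :=
  ∀ (K : Finset ι) (s : ι → Bool), K.card ≤ q →
    a * 2⁻¹ ^ K.card ≤ μ (subcube K s) ∧ μ (subcube K s) ≤ b * 2⁻¹ ^ K.card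

namespace IsAlmostUniform

variable {q : ℕ} {a b a' b' : ℝ≥0} {μ ν : Measure (ι → Bool)}

theorem isFiniteMeasure (h : IsAlmostUniform q a b μ) : IsFiniteMeasure μ := by
  refine ⟨?_⟩
  have := (h ∅ (fun _ => true) (Nat.zero_le q)).2
  simp only [subcube_empty, Finset.card_empty, pow_zero, mul_one] at this
  exact this.trans_lt ENNReal.coe_lt_top

theorem ne_zero (h : IsAlmostUniform q a b μ) (ha : a ≠ 0) : μ ≠ 0 := by
  rintro rfl
  simpa [ha] using (h ∅ (fun _ => true) (Nat.zero_le q)).1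

theorem subcubeLE (hμ : IsAlmostUniform q a b μ) (hν : IsAlmostUniform q a' b' ν) :
    SubcubeLE q (a' • μ) (b • ν) := fun K s hK => by
  simp only [Measure.smul_apply, ENNReal.smul_def, smul_eq_mul]
  calc (a' : ℝ≥0∞) * μ (subcube K s) ≤ a' * (b * 2⁻¹ ^ K.card) := by gcongr; exact (hμ K s hK).2
    _ = b * (a' * 2⁻¹ ^ K.card) := by ring
    _ ≤ b * ν (subcube K s) := by gcongr; exact (hν K s hK).1

theorem restrict (h : IsAlmostUniform q a b μ) {G : Set (ι → Bool)} (hG : MeasurableSet G)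
    {δ : ℝ≥0} (hδ : ∀ (K : Finset ι) (s : ι → Bool), K.card ≤ q →
      μ (subcube K s \ G) ≤ δ * 2⁻¹ ^ K.card) :
    IsAlmostUniform q (a - δ) b (μ.restrict G) := fun K s hK => by
  rw [Measure.restrict_apply (measurableSet_subcube K s)]
  refine ⟨?_, (measure_mono Set.inter_subset_left).trans (h K s hK).2⟩
  rw [ENNReal.coe_sub, ENNReal.sub_mul fun _ _ => by finiteness, tsub_le_iff_right]
  calc (a : ℝ≥0∞) * 2⁻¹ ^ K.card ≤ μ (subcube K s) := (h K s hK).1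
    _ = μ (subcube K s ∩ G) + μ (subcube K s \ G) := (measure_inter_add_sdiff _ hG).symm
    _ ≤ μ (subcube K s ∩ G) + δ * 2⁻¹ ^ K.card := by gcongr; exact hδ K s hK

end IsAlmostUniform

end Subcube

namespace QueryTree

variable {ι : Type}

theorem setOf_run_query (i : ι) (t₀ t₁ : QueryTree ι) (o : PathOutcome) :
    {z | (query i t₀ t₁).run z = o} =
      {z | z i = true} ∩ {z | t₁.run z = o} ∪ {z | z i = false} ∩ {z | t₀.run z = o} := by
  ext z
  cases h : z i <;> simp [run, h]

theorem measurableSet_setOf_run_eq (t : QueryTree ι) (o : PathOutcome) :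
    MeasurableSet {z | t.run z = o} := by
  induction t with
  | leaf o' => exact MeasurableSet.const (o' = o)
  | query i t₀ t₁ ih₀ ih₁ =>
    rw [setOf_run_query]
    exact ((measurableSet_setOf_apply_eq i true).inter ih₁).union
      ((measurableSet_setOf_apply_eq i false).inter ih₀)

theorem measure_subcube_inter_run_le {q : ℕ} {μ ν : Measure (ι → Bool)} (h : SubcubeLE q μ ν)
    (o : PathOutcome) (t : QueryTree ι) (K : Finset ι) (s : ι → Bool) (hK : K.card + t.depth ≤ q) :
    μ (subcube K s ∩ {z | t.run z = o}) ≤ ν (subcube K s ∩ {z | t.run z = o}) := by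
  classical
  induction t generalizing K s with
  | leaf o' =>
    by_cases ho : o' = o
    · simpa [run, ho] using h K s (by simpa [depth] using hK)
    · simp [run, ho]
  | query i t₀ t₁ ih₀ ih₁ =>
    simp only [depth] at hK
    have hcard := Finset.card_insert_le i K
    have branch {t : QueryTree ι} (ht : t.depth ≤ max t₀.depth t₁.depth)
        (ih : ∀ K s, K.card + t.depth ≤ q →
          μ (subcube K s ∩ {z | t.run z = o}) ≤ ν (subcube K s ∩ {z | t.run z = o})) (b : Bool) :
        μ (subcube K s ∩ ({z | z i = b} ∩ {z | t.run z = o})) ≤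
          ν (subcube K s ∩ ({z | z i = b} ∩ {z | t.run z = o})) := by
      rw [← Set.inter_assoc]
      rcases subcube_inter_eq_or K s i b with hb | hb <;> rw [hb]
      · simp
      · exact ih _ _ (by omega)
    have split (ξ : Measure (ι → Bool)) : ξ (subcube K s ∩ {z | (query i t₀ t₁).run z = o}) =
        ξ (subcube K s ∩ ({z | z i = true} ∩ {z | t₁.run z = o})) +
          ξ (subcube K s ∩ ({z | z i = false} ∩ {z | t₀.run z = o})) := by
      rw [setOf_run_query, Set.inter_union_distrib_left, measure_union]
      · exact Set.disjoint_left.2 fun z hz hz' => by simp_all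
      · exact (measurableSet_subcube K s).inter
          ((measurableSet_setOf_apply_eq i false).inter (measurableSet_setOf_run_eq t₀ o))
    rw [split, split]
    exact add_le_add (branch (le_max_right _ _) ih₁ true) (branch (le_max_left _ _) ih₀ false)

end QueryTree

namespace BPPPathAlgorithm

variable {ι : Type}

theorem prob_eq_tsum_support (A : BPPPathAlgorithm ι) (z : ι → Bool) (o : PathOutcome) :
    A.prob z o =
      ∑' t : A.support, {z | (t : QueryTree ι).run z = o}.indicator (fun _ => A t) z := by
  classical
  rw [prob, PMF.map_apply,
    tsum_subtype A.support fun t => {z | t.run z = o}.indicator (fun _ => A t) z]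
  refine tsum_congr fun t => ?_
  by_cases h : t ∈ A.support
  · simp [Set.indicator, h, eq_comm]
  · simp [Set.indicator, (A.apply_eq_zero_iff t).2 h]

@[fun_prop]
theorem measurable_prob (A : BPPPathAlgorithm ι) (o : PathOutcome) :
    Measurable fun z => A.prob z o := by
  have := A.support_countable.to_subtype
  simp only [prob_eq_tsum_support]
  exact Measurable.tsum fun t =>
    measurable_const.indicator (QueryTree.measurableSet_setOf_run_eq _ o)

theorem lintegral_prob (A : BPPPathAlgorithm ι) (μ : Measure (ι → Bool)) (o : PathOutcome) :
    ∫⁻ z, A.prob z o ∂μ = ∑' t : A.support, A t * μ {z | (t : QueryTree ι).run z = o} := by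
  have := A.support_countable.to_subtype
  have hmeas (t : A.support) := QueryTree.measurableSet_setOf_run_eq (t : QueryTree ι) o
  simp only [prob_eq_tsum_support]
  rw [lintegral_tsum fun t => (measurable_const.indicator (hmeas t)).aemeasurable]
  exact tsum_congr fun t => lintegral_indicator_const (hmeas t) _

theorem lintegral_prob_le {A : BPPPathAlgorithm ι} {q : ℕ} (hA : A.MakesAtMost q)
    {μ ν : Measure (ι → Bool)} (h : SubcubeLE q μ ν) (o : PathOutcome) :
    ∫⁻ z, A.prob z o ∂μ ≤ ∫⁻ z, A.prob z o ∂ν := by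
  rw [lintegral_prob, lintegral_prob]
  refine ENNReal.tsum_le_tsum fun t => mul_le_mul_right ?_ _
  simpa using QueryTree.measure_subcube_inter_run_le h o t ∅ (fun _ => true)
    (by simpa using hA t t.2)

theorem prob_le_one (A : BPPPathAlgorithm ι) (z : ι → Bool) (o : PathOutcome) : A.prob z o ≤ 1 :=
  PMF.coe_le_one _ _

theorem prob_ne_top (A : BPPPathAlgorithm ι) (z : ι → Bool) (o : PathOutcome) : A.prob z o ≠ ∞ :=
  PMF.apply_ne_top _ _

theorem lintegral_prob_ne_top (A : BPPPathAlgorithm ι) (μ : Measure (ι → Bool)) [IsFiniteMeasure μ]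
    (o : PathOutcome) : ∫⁻ z, A.prob z o ∂μ ≠ ∞ :=
  ne_top_of_le_ne_top (by simp) (lintegral_mono (g := 1) fun z => A.prob_le_one z o)

namespace Computes

variable {A : BPPPathAlgorithm ι} {F : (ι → Bool) → Option Bool} {z : ι → Bool}

theorem two_mul_reject_le (hA : A.Computes F) (hz : F z = some true) :
    2 * A.prob z .reject ≤ A.prob z .accept := by
  have hpos : 0 < A.prob z .accept + A.prob z .reject := hA.1 z (by simp [hz])
  have hacc : 2 / 3 ≤ A.prob z .accept / (A.prob z .accept + A.prob z .reject) := hA.2.1 z hz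
  have ha := A.prob_ne_top z .accept
  have hr := A.prob_ne_top z .reject
  rw [ENNReal.le_div_iff_mul_le (.inl hpos.ne') (.inl (by finiteness))] at hacc
  lift A.prob z .accept to ℝ≥0 using ha with a
  lift A.prob z .reject to ℝ≥0 using hr with r
  have hacc' := ENNReal.toReal_mono (by finiteness) hacc
  rw [← ENNReal.toReal_le_toReal (by finiteness) (by finiteness)]
  simp only [ENNReal.toReal_mul, ENNReal.toReal_div, ENNReal.toReal_ofNat, ne_eq,
    ENNReal.coe_ne_top, not_false_eq_true, ENNReal.toReal_add, ENNReal.coe_toReal] at hacc' ⊢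
  linarith

theorem two_mul_accept_le (hA : A.Computes F) (hz : F z = some false) :
    2 * A.prob z .accept ≤ A.prob z .reject := by
  have hpos : 0 < A.prob z .accept + A.prob z .reject := hA.1 z (by simp [hz])
  have hacc : A.prob z .accept / (A.prob z .accept + A.prob z .reject) ≤ 1 / 3 := hA.2.2 z hz
  have ha := A.prob_ne_top z .accept
  have hr := A.prob_ne_top z .reject
  rw [ENNReal.div_le_iff_le_mul (.inl hpos.ne') (.inl (by finiteness))] at hacc
  lift A.prob z .accept to ℝ≥0 using ha with a
  lift A.prob z .reject to ℝ≥0 using hr with r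
  have hacc' := ENNReal.toReal_mono (by finiteness) hacc
  rw [← ENNReal.toReal_le_toReal (by finiteness) (by finiteness)]
  simp only [ENNReal.coe_toReal, one_div, ENNReal.toReal_mul, ENNReal.toReal_inv,
    ENNReal.toReal_ofNat, ne_eq, ENNReal.coe_ne_top, not_false_eq_true,
    ENNReal.toReal_add] at hacc' ⊢
  linarith

theorem two_mul_lintegral_reject_le (hA : A.Computes F) {μ : Measure (ι → Bool)}
    (hμ : ∀ᵐ z ∂μ, F z = some true) :
    2 * ∫⁻ z, A.prob z .reject ∂μ ≤ ∫⁻ z, A.prob z .accept ∂μ := by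
  rw [← lintegral_const_mul _ (by fun_prop)]
  exact lintegral_mono_ae (hμ.mono fun z => hA.two_mul_reject_le)

theorem two_mul_lintegral_accept_le (hA : A.Computes F) {μ : Measure (ι → Bool)}
    (hμ : ∀ᵐ z ∂μ, F z = some false) :
    2 * ∫⁻ z, A.prob z .accept ∂μ ≤ ∫⁻ z, A.prob z .reject ∂μ := by
  rw [← lintegral_const_mul _ (by fun_prop)]
  exact lintegral_mono_ae (hμ.mono fun z => hA.two_mul_accept_le)

theorem lintegral_prob_pos (hA : A.Computes F) {μ : Measure (ι → Bool)} (hμ₀ : μ ≠ 0)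
    (hμ : ∀ᵐ z ∂μ, F z ≠ none) :
    0 < ∫⁻ z, A.prob z .accept ∂μ + ∫⁻ z, A.prob z .reject ∂μ := by
  rw [← lintegral_add_left (by fun_prop), pos_iff_ne_zero, Ne,
    lintegral_eq_zero_iff (by fun_prop)]
  intro h
  have hfalse : ∀ᵐ _ ∂μ, False := by
    filter_upwards [hμ, h] with z hz hz'
    exact (hA.1 z hz).ne' hz'
  exact hμ₀ (by simpa using hfalse)

end Computes

theorem four_mul_le_of_two_mul_mul_le {c d x y : ℝ≥0} (hpos : 0 < x + y) (hxy : 2 * x ≤ y)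
    (h : 2 * c * y ≤ d * x) : 4 * c ≤ d := by
  rcases eq_zero_or_pos x with rfl | hx
  · have hc : c = 0 := by simpa [(zero_add y ▸ hpos).ne'] using h
    simp [hc]
  · refine le_of_mul_le_mul_right ?_ hx
    calc 4 * c * x = 2 * c * (2 * x) := by ring
      _ ≤ 2 * c * y := by gcongr
      _ ≤ d * x := h

/-- On `1`-inputs acceptance outweighs rejection by a factor `2`, on `0`-inputs it is the other way
around, and a `q`-query algorithm sees a ratio of the two measures that varies by less than `4`. -/
theorem not_computes_of_isAlmostUniform {A : BPPPathAlgorithm ι} {q : ℕ} (hA : A.MakesAtMost q)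
    {F : (ι → Bool) → Option Bool} {μ₀ μ₁ : Measure (ι → Bool)}
    (hF₀ : ∀ᵐ z ∂μ₀, F z = some false) (hF₁ : ∀ᵐ z ∂μ₁, F z = some true) {a₀ b₀ a₁ b₁ : ℝ≥0}
    (h₀ : IsAlmostUniform q a₀ b₀ μ₀) (h₁ : IsAlmostUniform q a₁ b₁ μ₁)
    (hratio : b₀ * b₁ < 4 * (a₀ * a₁)) :
    ¬ A.Computes F := by
  intro hAF
  have := h₀.isFiniteMeasure
  have hle₁₀ := lintegral_prob_le hA (h₁.subcubeLE h₀) .accept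
  have hle₀₁ := lintegral_prob_le hA (h₀.subcubeLE h₁) .reject
  simp only [lintegral_smul_measure, ENNReal.smul_def, smul_eq_mul] at hle₁₀ hle₀₁
  have hrej := hAF.two_mul_lintegral_reject_le hF₁
  have hacc := hAF.two_mul_lintegral_accept_le hF₀
  have hpos := hAF.lintegral_prob_pos (h₀.ne_zero (by rintro rfl; simp at hratio))
    (hF₀.mono fun z hz => by simp [hz])
  have hacc_top := A.lintegral_prob_ne_top μ₀ .accept
  have hrej_top := A.lintegral_prob_ne_top μ₀ .reject
  set A₀ := ∫⁻ z, A.prob z .accept ∂μ₀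
  set R₀ := ∫⁻ z, A.prob z .reject ∂μ₀
  set A₁ := ∫⁻ z, A.prob z .accept ∂μ₁
  set R₁ := ∫⁻ z, A.prob z .reject ∂μ₁
  have hchain : 2 * (a₀ * a₁ : ℝ≥0) * R₀ ≤ (b₀ * b₁ : ℝ≥0) * A₀ :=
    calc 2 * (a₀ * a₁ : ℝ≥0) * R₀ = 2 * a₀ * (a₁ * R₀) := by push_cast; ring
      _ ≤ 2 * a₀ * (b₀ * R₁) := by gcongr
      _ = a₀ * b₀ * (2 * R₁) := by ring
      _ ≤ a₀ * b₀ * A₁ := by gcongr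
      _ = b₀ * (a₀ * A₁) := by ring
      _ ≤ b₀ * (b₁ * A₀) := by gcongr
      _ = (b₀ * b₁ : ℝ≥0) * A₀ := by push_cast; ring
  lift A₀ to ℝ≥0 using hacc_top with x
  lift R₀ to ℝ≥0 using hrej_top with y
  norm_cast at hchain hacc hpos
  exact (four_mul_le_of_two_mul_mul_le hpos hacc hchain).not_gt hratio

end BPPPathAlgorithm

section SignVectors

variable {X : Type*}

/-- The `±1` vector encoded by the bits `z`. -/
def signVec (z : X → Bool) (x : X) : ℝ := if z x then 1 else -1

/-- The bits encoding the signs of the coordinates of `u`. -/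
noncomputable def signBits (u : X → ℝ) (x : X) : Bool := decide (0 ≤ u x)

/-- The squared distance from `4 / 5 * t` to the sign of `t`. The mean of `(1 - a * |t|) ^ 2` for a
standard Gaussian `t` is minimal at `a = √(2 / π) ≈ 4 / 5`. -/
noncomputable def signLoss (t : ℝ) : ℝ := (1 - 4 / 5 * |t|) ^ 2

theorem signVec_mul_self (z : X → Bool) (x : X) : signVec z x * signVec z x = 1 := by
  cases h : z x <;> simp [signVec, h]

theorem signVec_signBits_sub_sq (u : X → ℝ) (x : X) :
    (signVec (signBits u) x - 4 / 5 * u x) ^ 2 = signLoss (u x) := by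
  rcases le_or_gt 0 (u x) with hx | hx
  · simp [signVec, signBits, signLoss, hx, abs_of_nonneg hx]
  · simp only [signVec, signBits, signLoss, not_le.2 hx, abs_of_neg hx, decide_false,
      Bool.false_eq_true, if_false]
    ring

variable [Fintype X]

theorem signVec_dotProduct_self (z : X → Bool) : signVec z ⬝ᵥ signVec z = Fintype.card X := by
  simp [dotProduct, signVec_mul_self]

theorem sum_signLoss (u : X → ℝ) :
    ∑ x, signLoss (u x) =
      (signVec (signBits u) - (4 / 5 : ℝ) • u) ⬝ᵥ (signVec (signBits u) - (4 / 5 : ℝ) • u) := by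
  simp [dotProduct, ← signVec_signBits_sub_sq, sq]

theorem sub_dotProduct_sub_self_le (p q : X → ℝ) :
    (p - q) ⬝ᵥ (p - q) ≤ 2 * (p ⬝ᵥ p + q ⬝ᵥ q) := by
  simp only [dotProduct, ← Finset.sum_add_distrib, Finset.mul_sum, Pi.sub_apply]
  exact Finset.sum_le_sum fun x _ => by nlinarith [sq_nonneg (p x + q x)]

end SignVectors

section MatrixForrelation

variable {X : Type*} [Fintype X]

/-- The forrelation of two `±1` vectors with respect to a matrix `H`; `For_n` is the case of the
normalised Hadamard matrix. -/
noncomputable def matrixForrelation (H : Matrix X X ℝ) (z : X ⊕ X → Bool) : ℝ :=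
  (Fintype.card X : ℝ)⁻¹ * (signVec (z ∘ .inl) ⬝ᵥ (H *ᵥ signVec (z ∘ .inr)))

/-- The linear map `v ↦ (v, Hᵀ v)`. -/
def forrelationForms [DecidableEq X] (H : Matrix X X ℝ) : Matrix (X ⊕ X) X ℝ := fromRows 1 Hᵀ

theorem mulVec_dotProduct_mulVec_of_transpose_mul_self [DecidableEq X] {H : Matrix X X ℝ}
    (hH : Hᵀ * H = 1) (u w : X → ℝ) :
    (H *ᵥ u) ⬝ᵥ (H *ᵥ w) = u ⬝ᵥ w := by
  rw [dotProduct_comm, dotProduct_mulVec, ← mulVec_transpose, mulVec_mulVec, hH, one_mulVec,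
    dotProduct_comm]

theorem sub_mulVec_dotProduct_self [DecidableEq X] {H : Matrix X X ℝ} (hH : Hᵀ * H = 1)
    (f g : X → ℝ) :
    (f - H *ᵥ g) ⬝ᵥ (f - H *ᵥ g) = f ⬝ᵥ f + g ⬝ᵥ g - 2 * (f ⬝ᵥ (H *ᵥ g)) := by
  rw [sub_dotProduct, dotProduct_sub, dotProduct_sub,
    mulVec_dotProduct_mulVec_of_transpose_mul_self hH, dotProduct_comm (H *ᵥ g) f]
  ring

theorem card_mul_one_sub_matrixForrelation_le_sum_signLoss [DecidableEq X] {H : Matrix X X ℝ}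
    (hH : Hᵀ * H = 1) (v : X → ℝ) :
    Fintype.card X * (1 - matrixForrelation H (signBits (forrelationForms H *ᵥ v))) ≤
      ∑ a, signLoss ((forrelationForms H *ᵥ v) a) := by
  rcases isEmpty_or_nonempty X with hX | hX
  · simp
  rw [forrelationForms, fromRows_mulVec, one_mulVec, Fintype.sum_sum_type]
  simp only [Sum.elim_inl, Sum.elim_inr]
  rw [sum_signLoss, sum_signLoss]
  set w := Hᵀ *ᵥ v
  have hw : H *ᵥ w = v := by rw [mulVec_mulVec, mul_eq_one_comm.1 hH, one_mulVec]
  set f := signVec (signBits v)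
  set g := signVec (signBits w)
  have hΦ : matrixForrelation H (signBits (Sum.elim v w)) =
      (Fintype.card X : ℝ)⁻¹ * (f ⬝ᵥ (H *ᵥ g)) := rfl
  have hexpand := sub_mulVec_dotProduct_self hH f g
  have hsplit : f - H *ᵥ g = (f - (4 / 5 : ℝ) • v) - H *ᵥ (g - (4 / 5 : ℝ) • w) := by
    rw [mulVec_sub, mulVec_smul, hw]
    abel
  have hle := sub_dotProduct_sub_self_le (f - (4 / 5 : ℝ) • v) (H *ᵥ (g - (4 / 5 : ℝ) • w))
  rw [← hsplit, mulVec_dotProduct_mulVec_of_transpose_mul_self hH] at hle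
  rw [signVec_dotProduct_self, signVec_dotProduct_self] at hexpand
  rw [hΦ, mul_sub, mul_one, mul_inv_cancel_left₀ (by simp)]
  linarith

end MatrixForrelation

section Hadamard

variable {n : ℕ}

/-- The normalised `2^n × 2^n` Hadamard matrix. -/
noncomputable def hadamardMatrix (n : ℕ) : Matrix (Fin n → Bool) (Fin n → Bool) ℝ :=
  of fun x y => (√(2 ^ n))⁻¹ * (-1) ^ (∑ i, (x i).toNat * (y i).toNat)

theorem hadamardMatrix_transpose : (hadamardMatrix n)ᵀ = hadamardMatrix n := by
  ext x y
  simp [hadamardMatrix, mul_comm]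

theorem abs_hadamardMatrix (x y : Fin n → Bool) : |hadamardMatrix n x y| = (√(2 ^ n))⁻¹ := by
  simp [hadamardMatrix, abs_mul, abs_pow]

theorem hadamardMatrix_mul_apply (x y z : Fin n → Bool) :
    hadamardMatrix n x z * hadamardMatrix n z y =
      (2 ^ n)⁻¹ * ∏ i, (-1 : ℝ) ^ ((x i).toNat * (z i).toNat + (z i).toNat * (y i).toNat) := by
  have hsqrt : (√(2 ^ n : ℝ))⁻¹ * (√(2 ^ n))⁻¹ = (2 ^ n)⁻¹ := by
    rw [← mul_inv, Real.mul_self_sqrt (by positivity)]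
  simp only [hadamardMatrix, of_apply, pow_add, Finset.prod_mul_distrib,
    Finset.prod_pow_eq_pow_sum, ← hsqrt]
  ring

theorem sum_neg_one_pow_toNat (b c : Bool) :
    ∑ d : Bool, (-1 : ℝ) ^ (b.toNat * d.toNat + d.toNat * c.toNat) = if b = c then 2 else 0 := by
  cases b <;> cases c <;> norm_num

theorem hadamardMatrix_mul_self : hadamardMatrix n * hadamardMatrix n = 1 := by
  ext x y
  have hprod := Finset.prod_univ_sum (fun _ : Fin n => (Finset.univ : Finset Bool))
    (fun i b => (-1 : ℝ) ^ ((x i).toNat * b.toNat + b.toNat * (y i).toNat))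
  rw [Fintype.piFinset_univ] at hprod
  simp only [mul_apply, hadamardMatrix_mul_apply, ← Finset.mul_sum, ← hprod, sum_neg_one_pow_toNat]
  by_cases hxy : x = y
  · subst hxy
    simp
  · obtain ⟨i, hi⟩ := Function.ne_iff.1 hxy
    rw [Finset.prod_eq_zero (Finset.mem_univ i) (by simp [hi]), one_apply_ne hxy, mul_zero]

theorem forrelation_bitSign (z : ForIndex n → Bool) :
    forrelation n (fun x => bitSign (z (.inl x))) (fun y => bitSign (z (.inr y))) =
      matrixForrelation (hadamardMatrix n) z := by
  have hnorm : (1 : ℝ) / 2 ^ (3 * (n : ℝ) / 2) = (2 ^ n)⁻¹ * (√(2 ^ n))⁻¹ := by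
    rw [one_div, ← mul_inv, Real.sqrt_eq_rpow, ← Real.rpow_natCast, ← Real.rpow_mul (by norm_num),
      ← Real.rpow_add (by norm_num)]
    congr 2
    ring
  have hsign (b : Bool) : ((bitSign b : ℤ) : ℝ) = if b then 1 else -1 := by
    cases b <;> simp [bitSign]
  simp only [forrelation, matrixForrelation, hsign, hnorm, dotProduct, mulVec, hadamardMatrix,
    of_apply, Finset.mul_sum, signVec, Function.comp_apply, Fintype.card_fun, Fintype.card_bool,
    Fintype.card_fin, Nat.cast_pow, Nat.cast_ofNat]
  exact Finset.sum_congr rfl fun x _ => Finset.sum_congr rfl fun y _ => by ring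

theorem For_eq_some_true {z : ForIndex n → Bool}
    (h : 7 / 100 ≤ matrixForrelation (hadamardMatrix n) z) : For n z = some true := by
  rw [← forrelation_bitSign] at h
  exact if_pos (by norm_num at h ⊢; exact h)

theorem For_eq_some_false {z : ForIndex n → Bool}
    (h : |matrixForrelation (hadamardMatrix n) z| ≤ 1 / 100) : For n z = some false := by
  rw [← forrelation_bitSign] at h
  have hlt := (abs_le.1 h).2
  refine (if_neg ?_).trans (if_pos ?_)
  · norm_num
    linarith
  · norm_num at h ⊢
    exact h

end Hadamard

section UniformInput

section Count

variable {ι : Type*}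

theorem card_subcube_mul_two_pow [Fintype ι] [DecidableEq ι] (K : Finset ι) (s : ι → Bool) :
    Finset.card {z | z ∈ subcube K s} * 2 ^ K.card = 2 ^ Fintype.card ι := by
  have hpi : ({z | z ∈ subcube K s} : Finset (ι → Bool)) =
      Fintype.piFinset fun i => if i ∈ K then {s i} else Finset.univ := by
    ext z
    simp only [Finset.mem_filter_univ, mem_subcube, Fintype.mem_piFinset]
    refine forall_congr' fun i => ?_
    by_cases hi : i ∈ K <;> simp [hi]
  have hcard (i : ι) :
      ((if i ∈ K then {s i} else Finset.univ : Finset Bool)).card = if i ∈ K then 1 else 2 := by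
    split_ifs <;> simp
  rw [hpi, Fintype.card_piFinset, Finset.prod_congr rfl fun i _ => hcard i, Finset.prod_ite]
  simp only [Finset.prod_const_one, Finset.prod_const, one_mul, ← pow_add]
  rw [← Finset.compl_filter, Finset.filter_mem_eq_inter, Finset.univ_inter,
    Finset.card_compl_add_card]

theorem uniformOn_univ_eq_card_div [Fintype ι] [DecidableEq ι] (S : Set (ι → Bool))
    [DecidablePred (· ∈ S)] :
    uniformOn Set.univ S = Finset.card {z | z ∈ S} / 2 ^ Fintype.card ι := by
  have hS : S = ({z | z ∈ S} : Finset (ι → Bool)) := by simp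
  rw [uniformOn_univ, Fintype.card_fun, Fintype.card_bool]
  conv_lhs => rw [hS, Measure.count_apply_finset]
  push_cast
  rfl

theorem uniformOn_univ_subcube [Finite ι] (K : Finset ι) (s : ι → Bool) :
    uniformOn Set.univ (subcube K s) = 2⁻¹ ^ K.card := by
  classical
  have := Fintype.ofFinite ι
  have hcard : (Finset.card {z | z ∈ subcube K s} : ℝ≥0∞) * 2 ^ K.card = 2 ^ Fintype.card ι := by
    exact_mod_cast card_subcube_mul_two_pow K s
  rw [uniformOn_univ_eq_card_div, eq_comm, ENNReal.eq_div_iff (by simp) (by simp), ← hcard,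
    ← ENNReal.inv_pow, mul_assoc, ENNReal.mul_inv_cancel (by simp) (by simp), mul_one]

theorem uniformOn_univ_le_of_card_le [Fintype ι] [DecidableEq ι] {S : Set (ι → Bool)}
    [DecidablePred (· ∈ S)] {δ : ℝ≥0} {K : Finset ι} {s : ι → Bool}
    (h : (Finset.card {z | z ∈ S} : ℝ) ≤ δ * Finset.card {z | z ∈ subcube K s}) :
    uniformOn Set.univ S ≤ δ * 2⁻¹ ^ K.card := by
  have h' : (Finset.card {z | z ∈ S} : ℝ≥0∞) ≤ δ * Finset.card {z | z ∈ subcube K s} := by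
    exact_mod_cast h
  rw [← uniformOn_univ_subcube K s, uniformOn_univ_eq_card_div, uniformOn_univ_eq_card_div,
    ← mul_div_assoc]
  gcongr

theorem isAlmostUniform_uniformOn_univ [Finite ι] (q : ℕ) :
    IsAlmostUniform q 1 1 (uniformOn (Set.univ : Set (ι → Bool))) := fun K s _ => by
  simp [uniformOn_univ_subcube]

/-- Flipping a free coordinate permutes the subcube. -/
theorem sum_subcube_eq_zero_of_update_eq_neg [Fintype ι] [DecidableEq ι] {K : Finset ι}
    (s : ι → Bool) {i : ι} (hi : i ∉ K) {G : (ι → Bool) → ℝ}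
    (hG : ∀ z, G (Function.update z i (!z i)) = -G z) :
    ∑ z with z ∈ subcube K s, G z = 0 := by
  refine Finset.sum_involution (fun z _ => Function.update z i (!z i)) (fun z _ => by simp [hG])
    (fun z _ _ h => by simpa using congrFun h i) (fun z hz => ?_) (fun z _ => by simp)
  simp only [Finset.mem_filter_univ, mem_subcube] at hz ⊢
  intro j hj
  rw [Function.update_of_ne (ne_of_mem_of_not_mem hj hi), hz j hj]

end Count

section SecondMoment

variable {X Y : Type*} [DecidableEq X] [DecidableEq Y]

theorem sum_mul_signVec_update_inr (u : (X → Bool) → Y → ℝ) {S : Finset Y} {y : Y} (hy : y ∉ S)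
    (z : X ⊕ Y → Bool) (b : Bool) :
    ∑ y' ∈ S, u (Function.update z (.inr y) b ∘ .inl) y' *
        signVec (Function.update z (.inr y) b ∘ .inr) y' =
      ∑ y' ∈ S, u (z ∘ .inl) y' * signVec (z ∘ .inr) y' := by
  refine Finset.sum_congr rfl fun y' hy' => ?_
  simp [signVec, ne_of_mem_of_not_mem hy' hy]

variable [Fintype X] [Fintype Y] {K : Finset (X ⊕ Y)} {s : X ⊕ Y → Bool}

theorem sum_subcube_mul_signVec_inr_eq_zero {y : Y} (hy : .inr y ∉ K) {A : (X ⊕ Y → Bool) → ℝ}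
    (hA : ∀ z b, A (Function.update z (.inr y) b) = A z) :
    ∑ z with z ∈ subcube K s, A z * signVec (z ∘ .inr) y = 0 := by
  refine sum_subcube_eq_zero_of_update_eq_neg s hy fun z => ?_
  rw [hA]
  cases h : z (.inr y) <;> simp [signVec, h]

theorem sum_subcube_add_sum_sq {S : Finset Y} (hS : ∀ y ∈ S, .inr y ∉ K)
    (u : (X → Bool) → Y → ℝ) {A : (X ⊕ Y → Bool) → ℝ}
    (hA : ∀ y ∈ S, ∀ z b, A (Function.update z (.inr y) b) = A z) :
    ∑ z with z ∈ subcube K s, (A z + ∑ y ∈ S, u (z ∘ .inl) y * signVec (z ∘ .inr) y) ^ 2 =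
      ∑ z with z ∈ subcube K s, (A z ^ 2 + ∑ y ∈ S, u (z ∘ .inl) y ^ 2) := by
  induction S using Finset.induction_on with
  | empty => simp
  | insert y S hy ih =>
    have hcross : ∑ z with z ∈ subcube K s,
        2 * (A z + ∑ y ∈ S, u (z ∘ .inl) y * signVec (z ∘ .inr) y) * u (z ∘ .inl) y *
          signVec (z ∘ .inr) y = 0 := by
      refine sum_subcube_mul_signVec_inr_eq_zero (hS y (by simp)) fun z b => ?_
      rw [hA y (by simp), sum_mul_signVec_update_inr u hy, Sum.update_inr_comp_inl]
    have hih := ih (fun y' hy' => hS y' (by simp [hy'])) (fun y' hy' => hA y' (by simp [hy']))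
    calc _ = ∑ z with z ∈ subcube K s,
          ((A z + ∑ y ∈ S, u (z ∘ .inl) y * signVec (z ∘ .inr) y) ^ 2 + u (z ∘ .inl) y ^ 2 +
            2 * (A z + ∑ y ∈ S, u (z ∘ .inl) y * signVec (z ∘ .inr) y) * u (z ∘ .inl) y *
              signVec (z ∘ .inr) y) := by
          refine Finset.sum_congr rfl fun z _ => ?_
          rw [Finset.sum_insert hy]
          linear_combination u (z ∘ .inl) y ^ 2 * signVec_mul_self (z ∘ .inr) y
      _ = _ := by
          rw [Finset.sum_add_distrib, hcross, add_zero, Finset.sum_add_distrib, hih,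
            ← Finset.sum_add_distrib]
          refine Finset.sum_congr rfl fun z _ => ?_
          rw [Finset.sum_insert hy]
          ring

theorem sum_subcube_dotProduct_signVec_sq_le (u : (X → Bool) → Y → ℝ) :
    ∑ z with z ∈ subcube K s, (u (z ∘ .inl) ⬝ᵥ signVec (z ∘ .inr)) ^ 2 ≤
      (K.card + 1) * ∑ z with z ∈ subcube K s, u (z ∘ .inl) ⬝ᵥ u (z ∘ .inl) := by
  let fixedPart (z : X ⊕ Y → Bool) : ℝ := ∑ y ∈ K.toRight, u (z ∘ .inl) y * signVec (z ∘ .inr) y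
  have hfixed (z : X ⊕ Y → Bool) :
      fixedPart z ^ 2 ≤ K.card * ∑ y ∈ K.toRight, u (z ∘ .inl) y ^ 2 := by
    refine sq_sum_le_card_mul_sum_sq.trans ?_
    have hsq (y : Y) : (u (z ∘ .inl) y * signVec (z ∘ .inr) y) ^ 2 = u (z ∘ .inl) y ^ 2 := by
      linear_combination u (z ∘ .inl) y ^ 2 * signVec_mul_self (z ∘ .inr) y
    simp only [hsq]
    gcongr
    exact Finset.card_toRight_le
  have hsplit := sum_subcube_add_sum_sq (S := K.toRightᶜ) (K := K) (s := s) (A := fixedPart)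
    (by simp) u fun y hy => sum_mul_signVec_update_inr u (Finset.mem_compl.1 hy)
  simp only [fixedPart, Finset.sum_add_sum_compl] at hsplit
  simp only [dotProduct]
  rw [hsplit, Finset.mul_sum]
  refine Finset.sum_le_sum fun z _ => ?_
  have hfree : 0 ≤ ∑ y ∈ K.toRightᶜ, u (z ∘ .inl) y ^ 2 := by positivity
  have hpos : 0 ≤ ∑ y ∈ K.toRight, u (z ∘ .inl) y ^ 2 := by positivity
  simp only [← sq]
  rw [← Finset.sum_add_sum_compl K.toRight fun y => u (z ∘ .inl) y ^ 2]
  have := hfixed z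
  simp only [fixedPart] at this
  nlinarith [mul_nonneg (Nat.cast_nonneg (α := ℝ) K.card) hfree]

end SecondMoment

section Forrelation

variable {X : Type*} [Fintype X] [DecidableEq X] {H : Matrix X X ℝ}

theorem sum_subcube_matrixForrelation_sq_le (hH : Hᵀ * H = 1) (K : Finset (X ⊕ X))
    (s : X ⊕ X → Bool) :
    Fintype.card X * ∑ z with z ∈ subcube K s, matrixForrelation H z ^ 2 ≤
      (K.card + 1) * Finset.card {z | z ∈ subcube K s} := by
  rcases isEmpty_or_nonempty X with hX | hX
  · rw [Fintype.card_eq_zero, Nat.cast_zero, zero_mul]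
    positivity
  have hle := sum_subcube_dotProduct_signVec_sq_le (K := K) (s := s) fun f => Hᵀ *ᵥ signVec f
  have hHt : Hᵀᵀ * Hᵀ = 1 := by rw [transpose_transpose, mul_eq_one_comm.1 hH]
  have hΦ (z : X ⊕ X → Bool) : (Hᵀ *ᵥ signVec (z ∘ .inl)) ⬝ᵥ signVec (z ∘ .inr) =
      Fintype.card X * matrixForrelation H z := by
    rw [matrixForrelation, mul_inv_cancel_left₀ (by simp), dotProduct_mulVec, mulVec_transpose]
  simp only [hΦ, mulVec_dotProduct_mulVec_of_transpose_mul_self hHt, signVec_dotProduct_self,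
    mul_pow, ← Finset.mul_sum, Finset.sum_const, nsmul_eq_mul] at hle
  have hN : (0 : ℝ) < Fintype.card X := by simp [Fintype.card_pos]
  nlinarith

theorem uniformOn_univ_subcube_sdiff_le (hH : Hᵀ * H = 1) {δ c : ℝ≥0} (K : Finset (X ⊕ X))
    (hδ : K.card + 1 ≤ δ * c ^ 2 * Fintype.card X) (s : X ⊕ X → Bool) :
    uniformOn Set.univ (subcube K s \ {z | |matrixForrelation H z| ≤ c}) ≤ δ * 2⁻¹ ^ K.card := by
  classical
  have hmoment := sum_subcube_matrixForrelation_sq_le hH K s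
  set C : Finset (X ⊕ X → Bool) := {z | z ∈ subcube K s}
  set B : Finset (X ⊕ X → Bool) := {z | z ∈ subcube K s \ {z | |matrixForrelation H z| ≤ c}}
  have hmarkov : c ^ 2 * (B.card : ℝ) ≤ ∑ z ∈ C, matrixForrelation H z ^ 2 := by
    rw [mul_comm, ← nsmul_eq_mul]
    refine (Finset.card_nsmul_le_sum B _ _ fun z hz => ?_).trans
      (Finset.sum_le_sum_of_subset_of_nonneg (fun z hz => ?_) fun _ _ _ => sq_nonneg _)
    · have : c < |matrixForrelation H z| := by simp_all [B]
      rw [← sq_abs (matrixForrelation H z)]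
      gcongr
    · simp_all [B, C]
  refine uniformOn_univ_le_of_card_le (s := s) ?_
  have hpos : (0 : ℝ) < δ * c ^ 2 * Fintype.card X := by
    have : (0 : ℝ) < K.card + 1 := by positivity
    exact this.trans_le (mod_cast hδ)
  have hcN : (0 : ℝ) < c ^ 2 * Fintype.card X := by
    rw [mul_assoc] at hpos
    exact pos_of_mul_pos_right hpos δ.2
  refine le_of_mul_le_mul_left ?_ hcN
  calc c ^ 2 * Fintype.card X * (B.card : ℝ) = Fintype.card X * (c ^ 2 * B.card) := by ring
    _ ≤ Fintype.card X * ∑ z ∈ C, matrixForrelation H z ^ 2 := by gcongr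
    _ ≤ (K.card + 1) * C.card := hmoment
    _ ≤ δ * c ^ 2 * Fintype.card X * C.card := by gcongr; exact_mod_cast hδ
    _ = c ^ 2 * Fintype.card X * (δ * C.card) := by ring

theorem isAlmostUniform_uniformOn_restrict (hH : Hᵀ * H = 1) {q : ℕ} {δ c : ℝ≥0}
    (hδ : q + 1 ≤ δ * c ^ 2 * Fintype.card X) :
    IsAlmostUniform q (1 - δ) 1
      ((uniformOn Set.univ).restrict {z | |matrixForrelation H z| ≤ c}) :=
  (isAlmostUniform_uniformOn_univ q).restrict (Set.toFinite _).measurableSet fun K s hK =>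
    uniformOn_univ_subcube_sdiff_le hH K (le_trans (by gcongr) hδ) s

end Forrelation

end UniformInput

section IsotropicGaussian

/-- The centred isotropic Gaussian measure on `κ → ℝ` whose coordinates have variance `v`. -/
noncomputable def gaussianPi (κ : Type*) [Fintype κ] (v : ℝ≥0) : Measure (κ → ℝ) :=
  Measure.pi fun _ => gaussianReal 0 v

@[fun_prop]
theorem measurable_mulVec {κ X : Type*} [Fintype X] (L : Matrix κ X ℝ) :
    Measurable fun v : X → ℝ => L *ᵥ v :=
  measurable_pi_iff.2 fun _ => Finset.measurable_sum _ fun b _ =>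
    (measurable_pi_apply b).const_mul _

variable {κ X : Type*} [Fintype κ] [Fintype X]

instance (v : ℝ≥0) : IsProbabilityMeasure (gaussianPi κ v) := by
  unfold gaussianPi; infer_instance

theorem lintegral_prod_gaussianPi {v : ℝ≥0} {e : κ → ℝ → ℝ≥0∞} (he : ∀ a, Measurable (e a)) :
    ∫⁻ z, ∏ a, e a (z a) ∂gaussianPi κ v = ∏ a, ∫⁻ t, e a t ∂gaussianReal 0 v := by
  refine (lintegral_prod_eq_prod_lintegral_of_indepFun Finset.univ
    (fun a (z : κ → ℝ) => e a (z a)) (iIndepFun_pi fun a => (he a).aemeasurable)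
    fun a => (he a).comp (measurable_pi_apply a)).trans ?_
  exact Finset.prod_congr rfl fun a _ =>
    (measurePreserving_eval (fun _ => gaussianReal 0 v) a).lintegral_comp (he a)

theorem map_smul_gaussianPi (c : ℝ≥0) (v : ℝ≥0) :
    (gaussianPi κ v).map (fun z => c • z) = gaussianPi κ (c ^ 2 * v) := by
  have hscale : (gaussianReal 0 v).map (fun t => (c : ℝ) * t) = gaussianReal 0 (c ^ 2 * v) := by
    rw [gaussianReal_map_const_mul, mul_zero]
    congr
  have := Measure.isProbabilityMeasure_map (μ := gaussianReal 0 v) (f := fun t => (c : ℝ) * t)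
    (by fun_prop)
  rw [gaussianPi, gaussianPi, ← hscale, ← Measure.pi_map_pi (by fun_prop)]
  rfl

theorem gaussianPi_eq_withDensity {v : ℝ≥0} (hv : v ≠ 0) :
    gaussianPi κ v =
      volume.withDensity fun z => ENNReal.ofReal (∏ i, gaussianPDFReal 0 v (z i)) := by
  refine Measure.pi_eq fun s hs => ?_
  rw [withDensity_apply _ (MeasurableSet.univ_pi hs), volume_pi, Measure.restrict_pi_pi,
    ← ofReal_integral_eq_lintegral_ofReal
      (Integrable.fintype_prod fun i => (integrable_gaussianPDFReal 0 v).restrict)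
      (.of_forall fun z => Finset.prod_nonneg fun i _ => gaussianPDFReal_nonneg 0 v _),
    integral_fintype_prod_eq_prod (fun _ => gaussianPDFReal 0 v),
    ENNReal.ofReal_prod_of_nonneg fun i _ => integral_nonneg fun t => gaussianPDFReal_nonneg 0 v t]
  exact Finset.prod_congr rfl fun i _ => (gaussianReal_apply_eq_integral 0 hv (s i)).symm

theorem prod_gaussianPDFReal_le {v : ℝ≥0} {z z' : κ → ℝ} (h : z' ⬝ᵥ z' ≤ z ⬝ᵥ z) :
    ∏ i, gaussianPDFReal 0 v (z i) ≤ ∏ i, gaussianPDFReal 0 v (z' i) := by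
  simp only [gaussianPDFReal, Finset.prod_mul_distrib, ← Real.exp_sum, sub_zero, neg_div,
    Finset.sum_neg_distrib, ← Finset.sum_div]
  simp only [dotProduct, ← sq] at h
  gcongr

end IsotropicGaussian

section GaussianComparison

variable {κ X : Type*} [Fintype κ] [Fintype X]

theorem nnnorm_det_smul_map_mulVec_gaussianPi [DecidableEq κ] {P : Matrix κ κ ℝ}
    (hP : P.det ≠ 0) :
    ‖P.det‖₊ • (gaussianPi κ 1).map (P *ᵥ ·) =
      volume.withDensity fun u => ENNReal.ofReal (∏ i, gaussianPDFReal 0 1 ((P⁻¹ *ᵥ u) i)) := by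
  have hdet : IsUnit P.det := isUnit_iff_ne_zero.2 hP
  have hcancel : (‖P.det‖₊ : ℝ≥0∞) * ENNReal.ofReal |P.det⁻¹| = 1 := by
    rw [← enorm_eq_nnnorm, Real.enorm_eq_ofReal_abs, ← ENNReal.ofReal_mul (abs_nonneg _),
      ← abs_mul, mul_inv_cancel₀ hP, abs_one, ENNReal.ofReal_one]
  have hvolume : volume = (‖P.det‖₊ : ℝ≥0∞) • (volume : Measure (κ → ℝ)).map (P *ᵥ ·) := by
    rw [show (P *ᵥ · : (κ → ℝ) → κ → ℝ) = toLin' P from rfl,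
      Real.map_matrix_volume_pi_eq_smul_volume_pi hP, smul_smul, hcancel, one_smul]
  conv_rhs => rw [hvolume, withDensity_smul_measure]
  rw [ENNReal.smul_def]
  congr 1
  ext s hs
  rw [Measure.map_apply (by fun_prop) hs, gaussianPi_eq_withDensity one_ne_zero,
    withDensity_apply _ (hs.preimage (by fun_prop)), withDensity_apply _ hs,
    setLIntegral_map hs (by fun_prop) (by fun_prop)]
  simp only [Matrix.mulVec_mulVec, nonsing_inv_mul P hdet, one_mulVec]

theorem nnnorm_det_smul_map_mulVec_gaussianPi_le [DecidableEq κ] {P Q : Matrix κ κ ℝ}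
    (hP : P.det ≠ 0) (hQ : Q.det ≠ 0) (h : ∀ z z', P *ᵥ z = Q *ᵥ z' → z' ⬝ᵥ z' ≤ z ⬝ᵥ z) :
    ‖P.det‖₊ • (gaussianPi κ 1).map (P *ᵥ ·) ≤ ‖Q.det‖₊ • (gaussianPi κ 1).map (Q *ᵥ ·) := by
  rw [nnnorm_det_smul_map_mulVec_gaussianPi hP, nnnorm_det_smul_map_mulVec_gaussianPi hQ]
  refine withDensity_mono (.of_forall fun u => ENNReal.ofReal_le_ofReal ?_)
  refine prod_gaussianPDFReal_le (h _ _ ?_)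
  simp only [Matrix.mulVec_mulVec, mul_nonsing_inv _ (isUnit_iff_ne_zero.2 hP),
    mul_nonsing_inv _ (isUnit_iff_ne_zero.2 hQ)]

theorem map_sqrt_smul_one_mulVec_gaussianPi [DecidableEq κ] (v : ℝ≥0) :
    (gaussianPi κ 1).map (((NNReal.sqrt v : ℝ) • (1 : Matrix κ κ ℝ)) *ᵥ ·) = gaussianPi κ v := by
  simp only [smul_mulVec, one_mulVec]
  exact (map_smul_gaussianPi _ 1).trans (by rw [NNReal.sq_sqrt, mul_one])

theorem nnnorm_det_sqrt_smul_one [DecidableEq κ] (v : ℝ≥0) :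
    ‖((NNReal.sqrt v : ℝ) • (1 : Matrix κ κ ℝ)).det‖₊ = NNReal.sqrt v ^ Fintype.card κ := by
  rw [det_smul, det_one, mul_one, nnnorm_pow, NNReal.nnnorm_eq]

theorem sqrt_smul_one_mulVec_dotProduct_self [DecidableEq κ] (v : ℝ≥0) (z : κ → ℝ) :
    (((NNReal.sqrt v : ℝ) • (1 : Matrix κ κ ℝ)) *ᵥ z) ⬝ᵥ
      (((NNReal.sqrt v : ℝ) • (1 : Matrix κ κ ℝ)) *ᵥ z) = v * (z ⬝ᵥ z) := by
  rw [smul_mulVec, one_mulVec, smul_dotProduct, dotProduct_smul, smul_smul, smul_eq_mul,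
    ← NNReal.coe_mul, NNReal.mul_self_sqrt]

theorem det_ne_zero_of_mul_dotProduct_self_le [DecidableEq κ] {M : Matrix κ κ ℝ} {a : ℝ}
    (ha : 0 < a) (hlo : ∀ t, a * (t ⬝ᵥ t) ≤ (M *ᵥ t) ⬝ᵥ (M *ᵥ t)) : M.det ≠ 0 := by
  intro hdet
  obtain ⟨t, ht, hMt⟩ := exists_mulVec_eq_zero_iff.2 hdet
  have hpos : 0 < t ⬝ᵥ t := by simpa using dotProduct_star_self_pos_iff.2 ht
  have := hlo t
  rw [hMt, dotProduct_zero] at this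
  nlinarith

theorem sqrt_pow_smul_map_mulVec_gaussianPi_sandwich_of_square {M : Matrix κ κ ℝ} {a b : ℝ≥0}
    (ha : 0 < a) (hb : 0 < b) (hlo : ∀ t, a * (t ⬝ᵥ t) ≤ (M *ᵥ t) ⬝ᵥ (M *ᵥ t))
    (hup : ∀ t, (M *ᵥ t) ⬝ᵥ (M *ᵥ t) ≤ b * (t ⬝ᵥ t)) :
    NNReal.sqrt a ^ Fintype.card κ • (gaussianPi κ 1).map (M *ᵥ ·) ≤
        NNReal.sqrt b ^ Fintype.card κ • gaussianPi κ b ∧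
      NNReal.sqrt a ^ Fintype.card κ • gaussianPi κ a ≤
        NNReal.sqrt b ^ Fintype.card κ • (gaussianPi κ 1).map (M *ᵥ ·) := by
  classical
  have hdetM := det_ne_zero_of_mul_dotProduct_self_le (by exact_mod_cast ha) hlo
  have hdet {v : ℝ≥0} (hv : 0 < v) : ((NNReal.sqrt v : ℝ) • (1 : Matrix κ κ ℝ)).det ≠ 0 := by
    rw [← nnnorm_ne_zero_iff, nnnorm_det_sqrt_smul_one]
    exact pow_ne_zero _ (NNReal.sqrt_pos.2 hv).ne'
  have hupper := nnnorm_det_smul_map_mulVec_gaussianPi_le hdetM (hdet hb) fun z z' hz => by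
    have := hup z
    rw [hz, sqrt_smul_one_mulVec_dotProduct_self] at this
    exact le_of_mul_le_mul_left this (by exact_mod_cast hb)
  have hlower := nnnorm_det_smul_map_mulVec_gaussianPi_le (hdet ha) hdetM fun z z' hz => by
    have := hlo z'
    rw [← hz, sqrt_smul_one_mulVec_dotProduct_self] at this
    exact le_of_mul_le_mul_left this (by exact_mod_cast ha)
  rw [map_sqrt_smul_one_mulVec_gaussianPi, nnnorm_det_sqrt_smul_one] at hupper hlower
  have := Measure.isProbabilityMeasure_map (μ := gaussianPi κ 1) (f := (M *ᵥ ·)) (by fun_prop)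
  have hmass {c d : ℝ≥0} {μ ν : Measure (κ → ℝ)} [IsProbabilityMeasure μ] [IsProbabilityMeasure ν]
      (h : c • μ ≤ d • ν) : c ≤ d := by
    have := h Set.univ
    rwa [Measure.smul_apply, Measure.smul_apply, measure_univ, measure_univ, ENNReal.smul_def,
      ENNReal.smul_def, smul_eq_mul, smul_eq_mul, mul_one, mul_one, ENNReal.coe_le_coe] at this
  -- Comparing total masses trades the unknown `|det M|` for powers of `√a` and `√b`.
  have hdet_le := hmass hupper
  have hle_det := hmass hlower
  exact ⟨le_trans (by gcongr) hupper, hlower.trans (by gcongr)⟩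

theorem charFunDual_map_mulVec_gaussianPi [DecidableEq κ] (L : Matrix κ X ℝ)
    (l : StrongDual ℝ (κ → ℝ)) :
    charFunDual ((gaussianPi X 1).map (L *ᵥ ·)) l =
      Complex.exp (-(((fun a => l (Pi.single a 1)) ⬝ᵥ
        ((L * Lᵀ) *ᵥ fun a => l (Pi.single a 1)) : ℝ) : ℂ) / 2) := by
  set c : κ → ℝ := fun a => l (Pi.single a 1)
  have hdual (w : κ → ℝ) : l w = c ⬝ᵥ w := by
    conv_lhs => rw [← Finset.univ_sum_single w, map_sum]
    refine Finset.sum_congr rfl fun a _ => ?_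
    rw [mul_comm, ← smul_eq_mul, ← map_smul, ← Pi.single_smul, smul_eq_mul, mul_one]
  have hl (v : X → ℝ) : l (L *ᵥ v) = ∑ x, (c ᵥ* L) x * v x := by
    rw [hdual, dotProduct_mulVec, dotProduct]
  have hnorm : c ⬝ᵥ ((L * Lᵀ) *ᵥ c) = ∑ x, (c ᵥ* L) x ^ 2 := by
    rw [← mulVec_mulVec, dotProduct_mulVec, mulVec_transpose, dotProduct]
    simp only [sq]
  rw [charFunDual_apply, integral_map (by fun_prop) (by fun_prop), hnorm, gaussianPi]
  simp only [hl, Complex.ofReal_sum, Finset.sum_mul, Complex.exp_sum, Complex.ofReal_mul]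
  rw [integral_fintype_prod_eq_prod
    (fun x (t : ℝ) => Complex.exp (((c ᵥ* L) x : ℂ) * (t : ℂ) * Complex.I))]
  simp only [← charFun_apply_real, charFun_gaussianReal]
  rw [← Complex.exp_sum]
  simp [Finset.sum_div, Finset.sum_neg_distrib, neg_div]

theorem map_mulVec_gaussianPi_eq {ι Y : Type*} [Finite ι] [Fintype Y] {L : Matrix ι X ℝ}
    {M : Matrix ι Y ℝ}
    (h : L * Lᵀ = M * Mᵀ) :
    (gaussianPi X 1).map (L *ᵥ ·) = (gaussianPi Y 1).map (M *ᵥ ·) := by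
  classical
  have := Fintype.ofFinite ι
  refine Measure.ext_of_charFunDual (funext fun l => ?_)
  rw [charFunDual_map_mulVec_gaussianPi, charFunDual_map_mulVec_gaussianPi, h]

open scoped MatrixOrder in
theorem exists_symmetric_mul_self_eq_mul_transpose (L : Matrix κ X ℝ) :
    ∃ M : Matrix κ κ ℝ, Mᵀ = M ∧ M * M = L * Lᵀ := by
  classical
  have hpsd : (L * Lᵀ).PosSemidef := by
    simpa [conjTranspose_eq_transpose_of_trivial] using posSemidef_self_mul_conjTranspose L
  refine ⟨CFC.sqrt (L * Lᵀ), ?_, CFC.sqrt_mul_sqrt_self _ hpsd.nonneg⟩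
  simpa [star_eq_conjTranspose, conjTranspose_eq_transpose_of_trivial] using
    (CFC.sqrt_nonneg (L * Lᵀ)).isSelfAdjoint.star_eq

theorem sqrt_pow_smul_map_mulVec_gaussianPi_sandwich {L : Matrix κ X ℝ} {a b : ℝ≥0}
    (ha : 0 < a) (hb : 0 < b) (hlo : ∀ t, a * (t ⬝ᵥ t) ≤ t ⬝ᵥ ((L * Lᵀ) *ᵥ t))
    (hup : ∀ t, t ⬝ᵥ ((L * Lᵀ) *ᵥ t) ≤ b * (t ⬝ᵥ t)) :
    NNReal.sqrt a ^ Fintype.card κ • (gaussianPi X 1).map (L *ᵥ ·) ≤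
        NNReal.sqrt b ^ Fintype.card κ • gaussianPi κ b ∧
      NNReal.sqrt a ^ Fintype.card κ • gaussianPi κ a ≤
        NNReal.sqrt b ^ Fintype.card κ • (gaussianPi X 1).map (L *ᵥ ·) := by
  classical
  obtain ⟨M, hM, hMM⟩ := exists_symmetric_mul_self_eq_mul_transpose L
  have hquad (t : κ → ℝ) : t ⬝ᵥ ((L * Lᵀ) *ᵥ t) = (M *ᵥ t) ⬝ᵥ (M *ᵥ t) := by
    rw [← hMM, ← mulVec_mulVec, dotProduct_mulVec, ← mulVec_transpose, hM]
  simp only [hquad] at hlo hup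
  rw [map_mulVec_gaussianPi_eq (M := M) (by rw [hM, hMM])]
  exact sqrt_pow_smul_map_mulVec_gaussianPi_sandwich_of_square ha hb hlo hup

end GaussianComparison

section GaussianSigns

@[fun_prop]
theorem measurable_signBits {κ : Type*} : Measurable (signBits : (κ → ℝ) → κ → Bool) :=
  measurable_pi_iff.2 fun a => measurable_to_bool (by
    simpa [Set.preimage, signBits] using measurableSet_le measurable_const (measurable_pi_apply a))

@[fun_prop]
theorem measurable_boole_decide_nonneg (b : Bool) :
    Measurable fun t : ℝ => if decide (0 ≤ t) = b then (1 : ℝ≥0∞) else 0 := by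
  refine Measurable.ite ?_ measurable_const measurable_const
  cases b
  · simpa using measurableSet_lt measurable_id measurable_const
  · simpa using measurableSet_le measurable_const measurable_id

theorem lintegral_boole_decide_nonneg_mul {v : ℝ≥0} (hv : v ≠ 0) {e : ℝ → ℝ≥0∞}
    (he : Measurable e) (hev : e.Even) (b : Bool) :
    ∫⁻ t, (if decide (0 ≤ t) = b then 1 else 0) * e t ∂gaussianReal 0 v =
      2⁻¹ * ∫⁻ t, e t ∂gaussianReal 0 v := by
  have hne : ∀ᵐ t ∂gaussianReal 0 v, t ≠ 0 := by
    have := nullSingletonClass_gaussianReal (μ := 0) hv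
    simp [ae_iff]
  have hneg : MeasurePreserving (fun t : ℝ => -t) (gaussianReal 0 v) (gaussianReal 0 v) :=
    ⟨measurable_neg, by rw [gaussianReal_map_neg, neg_zero]⟩
  have hm : Measurable fun t => (if decide (0 ≤ t) = b then 1 else 0) * e t := by fun_prop
  have hflip : ∫⁻ t, (if decide (0 ≤ t) = b then 1 else 0) * e t ∂gaussianReal 0 v =
      ∫⁻ t, (if decide (0 ≤ t) = !b then 1 else 0) * e t ∂gaussianReal 0 v := by
    rw [← hneg.lintegral_comp hm]
    refine lintegral_congr_ae ?_
    filter_upwards [hne] with t ht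
    rw [hev]
    rcases lt_or_gt_of_ne ht with h | h <;> cases b <;> simp [h.le, not_le.2 h]
  have hsum : ∫⁻ t, e t ∂gaussianReal 0 v =
      ∫⁻ t, (if decide (0 ≤ t) = b then 1 else 0) * e t ∂gaussianReal 0 v +
      ∫⁻ t, (if decide (0 ≤ t) = !b then 1 else 0) * e t ∂gaussianReal 0 v := by
    rw [← lintegral_add_left hm]
    refine lintegral_congr fun t => ?_
    cases b <;> by_cases h : 0 ≤ t <;> simp [h]
  rw [hsum, ← hflip, ← two_mul, ← mul_assoc, ENNReal.inv_mul_cancel (by simp) (by simp), one_mul]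

variable {κ : Type*} [Fintype κ] {v : ℝ≥0}

theorem setLIntegral_signBits_preimage_subcube_prod (hv : v ≠ 0) (P : Finset κ) (s : κ → Bool)
    {e : κ → ℝ → ℝ≥0∞} (he : ∀ a, Measurable (e a)) (hev : ∀ a, (e a).Even) :
    ∫⁻ z in signBits ⁻¹' subcube P s, ∏ a, e a (z a) ∂gaussianPi κ v =
      2⁻¹ ^ P.card * ∏ a, ∫⁻ t, e a t ∂gaussianReal 0 v := by
  classical
  let boole (a : κ) (t : ℝ) : ℝ≥0∞ :=
    if a ∈ P then (if decide (0 ≤ t) = s a then 1 else 0) else 1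
  have hindicator (z : κ → ℝ) : (signBits ⁻¹' subcube P s).indicator
      (fun z => ∏ a, e a (z a)) z = ∏ a, boole a (z a) * e a (z a) := by
    rw [Finset.prod_mul_distrib, Finset.prod_ite_mem, Finset.univ_inter, Finset.prod_boole]
    simp [Set.indicator_apply, signBits]
  have hfactor (a : κ) : ∫⁻ t, boole a t * e a t ∂gaussianReal 0 v =
      (if a ∈ P then 2⁻¹ else 1) * ∫⁻ t, e a t ∂gaussianReal 0 v := by
    by_cases ha : a ∈ P
    · simp only [boole, ha, if_true]
      exact lintegral_boole_decide_nonneg_mul hv (he a) (hev a) _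
    · simp [boole, ha]
  have hmeas (a : κ) : Measurable (boole a) := by
    by_cases ha : a ∈ P <;> simp only [boole, ha, if_true, if_false] <;> fun_prop
  rw [← lintegral_indicator ((measurableSet_subcube P s).preimage measurable_signBits)]
  simp only [hindicator]
  rw [lintegral_prod_gaussianPi (e := fun a t => boole a t * e a t) fun a => by fun_prop]
  simp only [hfactor]
  rw [Finset.prod_mul_distrib, Finset.prod_ite_mem, Finset.univ_inter, Finset.prod_const]

theorem gaussianPi_signBits_preimage_subcube (hv : v ≠ 0) (P : Finset κ) (s : κ → Bool) :
    gaussianPi κ v (signBits ⁻¹' subcube P s) = 2⁻¹ ^ P.card := by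
  simpa using setLIntegral_signBits_preimage_subcube_prod hv P s (e := fun _ _ => 1)
    (fun _ => measurable_const) (fun _ _ => rfl)

theorem setLIntegral_signBits_preimage_subcube_mul [DecidableEq κ] (hv : v ≠ 0) (P : Finset κ)
    (s : κ → Bool) {f : ℝ → ℝ≥0∞} (hf : Measurable f) (hev : f.Even) (i j : κ) :
    ∫⁻ z in signBits ⁻¹' subcube P s, f (z i) * f (z j) ∂gaussianPi κ v =
      2⁻¹ ^ P.card * if i = j then ∫⁻ t, f t ^ 2 ∂gaussianReal 0 v
        else (∫⁻ t, f t ∂gaussianReal 0 v) ^ 2 := by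
  by_cases hij : i = j
  · subst hij
    have := setLIntegral_signBits_preimage_subcube_prod hv P s
      (e := fun a t => if a = i then f t ^ 2 else 1)
      (fun a => .ite (.const _) (hf.pow_const 2) measurable_const)
      (fun a t => by simp only [hev t])
    rw [Fintype.prod_eq_single i fun b hb => by simp [hb]] at this
    simpa [sq, Finset.prod_ite_eq'] using this
  · have := setLIntegral_signBits_preimage_subcube_prod hv P s
      (e := fun a t => if a = i ∨ a = j then f t else 1)
      (fun a => .ite (.const _) hf measurable_const)
      (fun a t => by simp only [hev t])
    rw [Fintype.prod_eq_mul i j hij fun b hb => by simp [hb.1, hb.2]] at this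
    rw [if_neg hij]
    refine Eq.trans (lintegral_congr fun z => ?_) (this.trans ?_)
    · rw [Fintype.prod_eq_mul i j hij fun b hb => by simp [hb.1, hb.2]]
      simp
    · simp [sq]

end GaussianSigns

section SignLossMoments

@[fun_prop]
theorem measurable_signLoss : Measurable signLoss := by unfold signLoss; fun_prop

theorem signLoss_nonneg (t : ℝ) : 0 ≤ signLoss t := sq_nonneg _

theorem signLoss_neg (t : ℝ) : signLoss (-t) = signLoss t := by simp [signLoss]

theorem integrable_pow_gaussianReal (k : ℕ) (v : ℝ≥0) :
    Integrable (fun t : ℝ => t ^ k) (gaussianReal 0 v) :=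
  integrable_pow_of_mem_interior_integrableExpSet (X := fun t => t)
    (by simp [integrableExpSet_fun_id_gaussianReal]) k

theorem integral_abs_gaussianReal (v : ℝ≥0) :
    ∫ t, |t| ∂gaussianReal 0 v = √(2 * v / Real.pi) := by
  rcases eq_or_ne v 0 with rfl | hv
  · simp
  have : (0 : ℝ) < v := by positivity
  let f (x : ℝ) : ℝ :=
    (√(2 * Real.pi * v))⁻¹ * (x ^ (1 : ℝ) * Real.exp (-(2 * (v : ℝ))⁻¹ * x ^ (2 : ℝ)))
  have hpdf (x : ℝ) : gaussianPDFReal 0 v x • |x| = f |x| := by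
    simp only [f, gaussianPDFReal, smul_eq_mul, Real.rpow_one, sub_zero, Real.rpow_two, sq_abs,
      neg_mul, div_eq_inv_mul]
    ring_nf
  rw [integral_gaussianReal_eq_integral_smul hv]
  simp only [hpdf]
  rw [integral_comp_abs, integral_const_mul,
    integral_rpow_mul_exp_neg_mul_rpow (by norm_num) (by norm_num) (by positivity)]
  norm_num
  rw [Real.rpow_neg_one]
  field_simp
  rw [Real.sq_sqrt zero_le_two, Real.sq_sqrt v.coe_nonneg, mul_comm]

theorem le_integral_abs_gaussianReal {v : ℝ≥0} (hv : 1 ≤ v) :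
    79 / 100 ≤ ∫ t, |t| ∂gaussianReal 0 v := by
  have : (1 : ℝ) ≤ v := hv
  rw [integral_abs_gaussianReal]
  refine Real.le_sqrt_of_sq_le ((le_div_iff₀ Real.pi_pos).2 ?_)
  linarith [Real.pi_lt_d2]

theorem integral_sq_gaussianReal (v : ℝ≥0) : ∫ t, t ^ 2 ∂gaussianReal 0 v = v := by
  have := variance_fun_id_gaussianReal (μ := 0) (v := v)
  rwa [variance_of_integral_eq_zero (by fun_prop) (by simp)] at this

theorem lintegral_signLoss_le {v : ℝ≥0} (hv : 1 ≤ v) (hv' : v ≤ 101 / 100) :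
    ∫⁻ t, ENNReal.ofReal (signLoss t) ∂gaussianReal 0 v ≤ (153 / 400 : ℝ≥0) := by
  have hsq_int := integrable_pow_gaussianReal 2 v
  have habs_int : Integrable (fun t : ℝ => |t|) (gaussianReal 0 v) := by
    simpa using (integrable_pow_gaussianReal 1 v).abs
  have hexpand : signLoss = fun t => 1 - 8 / 5 * |t| + 16 / 25 * t ^ 2 := by
    ext t
    rw [signLoss, ← sq_abs t]
    ring
  rw [← ofReal_integral_eq_lintegral_ofReal (by rw [hexpand]; fun_prop)
    (.of_forall signLoss_nonneg)]
  refine ENNReal.ofReal_le_coe.2 ?_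
  rw [hexpand, integral_add (by fun_prop) (by fun_prop), integral_sub (by fun_prop) (by fun_prop),
    integral_const_mul, integral_const_mul, integral_sq_gaussianReal]
  have hmean := le_integral_abs_gaussianReal hv
  have : (v : ℝ) ≤ 101 / 100 := by exact_mod_cast hv'
  simp only [integral_const, probReal_univ, smul_eq_mul]
  norm_num
  linarith

theorem signLoss_sq_le (t : ℝ) : signLoss t ^ 2 ≤ 4 * (Real.exp (2 * t) + Real.exp (-2 * t)) := by
  have hquad : signLoss t ≤ 2 * Real.exp |t| := by
    have := Real.quadratic_le_exp_of_nonneg (abs_nonneg t)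
    unfold signLoss
    nlinarith [abs_nonneg t, sq_nonneg |t|]
  calc signLoss t ^ 2 ≤ (2 * Real.exp |t|) ^ 2 := pow_le_pow_left₀ (signLoss_nonneg t) hquad 2
    _ = 4 * Real.exp (2 * |t|) := by rw [mul_pow, ← Real.exp_nat_mul]; norm_num
    _ ≤ 4 * (Real.exp (2 * t) + Real.exp (-2 * t)) := by
      gcongr
      rcases abs_cases t with ⟨h, -⟩ | ⟨h, -⟩ <;> rw [h]
      · exact le_add_of_nonneg_right (Real.exp_nonneg _)
      · rw [mul_neg, ← neg_mul]
        exact le_add_of_nonneg_left (Real.exp_nonneg _)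

theorem lintegral_signLoss_sq_le {v : ℝ≥0} (hv : v ≤ 101 / 100) :
    ∫⁻ t, ENNReal.ofReal (signLoss t) ^ 2 ∂gaussianReal 0 v ≤ (200 : ℝ≥0) := by
  have hexp (c : ℝ) : ∫ t, Real.exp (c * t) ∂gaussianReal 0 v = Real.exp (v * c ^ 2 / 2) := by
    simpa [mgf] using congrFun (mgf_fun_id_gaussianReal (μ := 0) (v := v)) c
  have hint (c : ℝ) := integrable_exp_mul_gaussianReal (μ := 0) (v := v) c
  have : (v : ℝ) ≤ 101 / 100 := by exact_mod_cast hv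
  calc ∫⁻ t, ENNReal.ofReal (signLoss t) ^ 2 ∂gaussianReal 0 v
      ≤ ∫⁻ t, ENNReal.ofReal (4 * (Real.exp (2 * t) + Real.exp (-2 * t))) ∂gaussianReal 0 v := by
        refine lintegral_mono fun t => ?_
        rw [← ENNReal.ofReal_pow (signLoss_nonneg t)]
        exact ENNReal.ofReal_le_ofReal (signLoss_sq_le t)
    _ = ENNReal.ofReal (8 * Real.exp (2 * v)) := by
        rw [← ofReal_integral_eq_lintegral_ofReal (by fun_prop) (.of_forall fun t => by positivity),
          integral_const_mul,
          integral_add (hint 2) (hint (-2)), hexp, hexp]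
        ring_nf
    _ ≤ (200 : ℝ≥0) := by
        refine ENNReal.ofReal_le_coe.2 ?_
        have he : Real.exp 1 ^ 3 ≤ 2.72 ^ 3 := by
          gcongr
          linarith [Real.exp_one_lt_d9]
        calc 8 * Real.exp (2 * v) ≤ 8 * Real.exp 1 ^ 3 := by
              rw [← Real.exp_nat_mul]
              gcongr 8 * ?_
              refine Real.exp_le_exp.2 ?_
              push_cast
              linarith
          _ ≤ 200 := by linarith

end SignLossMoments

section NearlyOrthonormalRows

variable {κ X : Type*} [Fintype κ] [Fintype X]

theorem abs_dotProduct_mulVec_le {E : Matrix κ κ ℝ} {δ : ℝ≥0} (hE : ∀ a b, |E a b| ≤ δ)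
    (t : κ → ℝ) : |t ⬝ᵥ (E *ᵥ t)| ≤ Fintype.card κ * δ * (t ⬝ᵥ t) := by
  calc |t ⬝ᵥ (E *ᵥ t)| = |∑ a, ∑ b, t a * E a b * t b| := by
        simp [dotProduct, mulVec, Finset.mul_sum, mul_assoc]
    _ ≤ ∑ a, ∑ b, |t a| * δ * |t b| := by
        refine (Finset.abs_sum_le_sum_abs _ _).trans (Finset.sum_le_sum fun a _ => ?_)
        refine (Finset.abs_sum_le_sum_abs _ _).trans (Finset.sum_le_sum fun b _ => ?_)
        rw [abs_mul, abs_mul]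
        gcongr
        exact hE a b
    _ = δ * (∑ a, |t a|) ^ 2 := by
        rw [sq, Finset.sum_mul_sum]
        simp only [Finset.mul_sum]
        exact Finset.sum_congr rfl fun a _ => Finset.sum_congr rfl fun b _ => by ring
    _ ≤ δ * (Fintype.card κ * (t ⬝ᵥ t)) := by
        gcongr
        simpa [dotProduct, sq] using sq_sum_le_card_mul_sum_sq (s := .univ) (f := fun a => |t a|)
    _ = Fintype.card κ * δ * (t ⬝ᵥ t) := by ring

theorem sqrt_one_add_pow_le {k : ℕ} {ε : ℝ≥0} (h : k * ε ≤ 1 / 1000) (hε : ε ≤ 1) :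
    NNReal.sqrt (1 + ε) ^ k ≤ 101 / 100 * NNReal.sqrt (1 - ε) ^ k := by
  have hupper : NNReal.sqrt (1 + ε) ^ k ≤ (1 + ε) ^ k :=
    pow_le_pow_left' (NNReal.sqrt_le_iff_le_sq.2 (le_self_pow₀ (by simp) two_ne_zero)) k
  have hlower : (1 - ε) ^ k ≤ NNReal.sqrt (1 - ε) ^ k :=
    pow_le_pow_left' (NNReal.le_sqrt_iff_sq_le.2
      (pow_le_of_le_one zero_le tsub_le_self two_ne_zero)) k
  refine hupper.trans (le_trans ?_ (mul_le_mul_right hlower _))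
  rw [← NNReal.coe_le_coe]
  push_cast [NNReal.coe_sub hε]
  have : (ε : ℝ) ≤ 1 := by exact_mod_cast hε
  have : (k * ε : ℝ) ≤ 1 / 1000 := by exact_mod_cast h
  have hbernoulli : 999 / 1000 ≤ (1 - ε : ℝ) ^ k := by
    have := one_add_mul_le_pow (a := -(ε : ℝ)) (by linarith) k
    rw [← sub_eq_add_neg] at this
    linarith
  have hprod : (1 + ε : ℝ) ^ k * (1 - ε) ^ k ≤ 1 := by
    rw [← mul_pow]
    exact pow_le_one₀ (by nlinarith [ε.coe_nonneg]) (by nlinarith [ε.coe_nonneg])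
  nlinarith

theorem le_smul_of_smul_le_smul {Ω : Type*} [MeasurableSpace Ω] {μ ν : Measure Ω} {a b c : ℝ≥0}
    (ha : 0 < a) (hb : b ≤ c * a) (h : a • μ ≤ b • ν) : μ ≤ c • ν := fun s => by
  have hs := h s
  simp only [Measure.smul_apply, ENNReal.smul_def, smul_eq_mul] at hs ⊢
  refine (ENNReal.mul_le_mul_iff_right (by exact_mod_cast ha.ne') ENNReal.coe_ne_top).1
    (hs.trans ?_)
  calc (b : ℝ≥0∞) * ν s ≤ (c * a : ℝ≥0) * ν s := by gcongr
    _ = a * (c * ν s) := by rw [ENNReal.coe_mul]; ring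

theorem map_mulVec_gaussianPi_le_and_le [DecidableEq κ] {L : Matrix κ X ℝ} {δ : ℝ≥0}
    (hL : ∀ a b, |(L * Lᵀ - (1 : Matrix κ κ ℝ)) a b| ≤ δ)
    (hδ : Fintype.card κ ^ 2 * δ ≤ 1 / 1000) :
    (gaussianPi X 1).map (L *ᵥ ·) ≤
        (101 / 100 : ℝ≥0) • gaussianPi κ (1 + Fintype.card κ * δ) ∧
      gaussianPi κ (1 - Fintype.card κ * δ) ≤
        (101 / 100 : ℝ≥0) • (gaussianPi X 1).map (L *ᵥ ·) := by
  set k := Fintype.card κ with hk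
  set ε : ℝ≥0 := k * δ with hε
  have hkε : k * ε ≤ 1 / 1000 := by rwa [hε, ← mul_assoc, ← sq]
  have hε_lt : ε < 1 := by
    rcases Nat.eq_zero_or_pos k with h0 | hpos
    · simp [hε, h0]
    · have : ε ≤ k * ε := le_mul_of_one_le_left zero_le (by exact_mod_cast hpos)
      exact (this.trans hkε).trans_lt (by norm_num)
  have hquad (t : κ → ℝ) : |t ⬝ᵥ ((L * Lᵀ) *ᵥ t) - t ⬝ᵥ t| ≤ ε * (t ⬝ᵥ t) := by
    have := abs_dotProduct_mulVec_le hL t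
    rw [sub_mulVec, one_mulVec, dotProduct_sub] at this
    exact_mod_cast this
  obtain ⟨hu, hl⟩ := sqrt_pow_smul_map_mulVec_gaussianPi_sandwich (L := L) (a := 1 - ε)
    (b := 1 + ε) (tsub_pos_of_lt hε_lt) (by positivity)
    (fun t => by
      push_cast [NNReal.coe_sub hε_lt.le]
      linarith [(abs_le.1 (hquad t)).1])
    (fun t => by
      push_cast
      linarith [(abs_le.1 (hquad t)).2])
  rw [← hk] at hu hl
  have hratio := sqrt_one_add_pow_le hkε hε_lt.le
  have hpos : 0 < NNReal.sqrt (1 - ε) ^ k := pow_pos (NNReal.sqrt_pos.2 (tsub_pos_of_lt hε_lt)) k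
  exact ⟨le_smul_of_smul_le_smul hpos hratio hu, le_smul_of_smul_le_smul hpos hratio hl⟩

end NearlyOrthonormalRows

section RoundedGaussian

variable {ι X : Type*} [Fintype X]

/-- The law of the signs of `A *ᵥ v` for a standard Gaussian vector `v`. -/
noncomputable def gaussianSigns (A : Matrix ι X ℝ) : Measure (ι → Bool) :=
  (gaussianPi X 1).map fun v => signBits (A *ᵥ v)

theorem preimage_restrict_signBits_preimage_subcube {K K' : Finset ι} [DecidablePred (· ∈ K')]
    (h : K ⊆ K') (s : ι → Bool) (A : Matrix ι X ℝ) :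
    (fun v => K'.restrict (A *ᵥ v)) ⁻¹'
        (signBits ⁻¹' subcube (K.subtype (· ∈ K')) (K'.restrict s)) =
      {v | signBits (A *ᵥ v) ∈ subcube K s} := by
  ext v
  simp only [Set.mem_preimage, Set.mem_ofPred_eq, mem_subcube, Finset.mem_subtype, Subtype.forall,
    signBits, Finset.restrict]
  exact ⟨fun H i hi => H i (h hi) hi, fun H i _ hi => H i hi⟩

theorem card_subtype_mem_of_subset {K K' : Finset ι} [DecidablePred (· ∈ K')] (h : K ⊆ K') :
    (K.subtype (· ∈ K')).card = K.card := by
  rw [Finset.card_subtype, Finset.filter_true_of_mem fun i hi => h hi]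

variable [DecidableEq ι] {A : Matrix ι X ℝ} {δ : ℝ≥0}

theorem map_restrict_mulVec_gaussianPi_le_and_le
    (hA : ∀ a b, |(A * Aᵀ - (1 : Matrix ι ι ℝ)) a b| ≤ δ) (K : Finset ι)
    (hδ : K.card ^ 2 * δ ≤ 1 / 1000) :
    (gaussianPi X 1).map (fun v => K.restrict (A *ᵥ v)) ≤
        (101 / 100 : ℝ≥0) • gaussianPi K (1 + K.card * δ) ∧
      gaussianPi K (1 - K.card * δ) ≤
        (101 / 100 : ℝ≥0) • (gaussianPi X 1).map (fun v => K.restrict (A *ᵥ v)) := by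
  have h := map_mulVec_gaussianPi_le_and_le (κ := K) (L := A.submatrix (↑) id) (δ := δ)
    (fun a b => by
      have := hA a b
      simp only [Matrix.sub_apply, Matrix.one_apply, Subtype.coe_inj] at this ⊢
      exact this)
    (by simpa using hδ)
  rw [Fintype.card_coe] at h
  exact h

theorem mul_le_of_sq_mul_le {k : ℕ} {c : ℝ≥0} (h : k ^ 2 * δ ≤ c) : k * δ ≤ c := by
  refine le_trans ?_ h
  gcongr
  exact_mod_cast Nat.le_self_pow two_ne_zero k

theorem isAlmostUniform_gaussianSigns (hA : ∀ a b, |(A * Aᵀ - (1 : Matrix ι ι ℝ)) a b| ≤ δ)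
    {q : ℕ} (hδ : q ^ 2 * δ ≤ 1 / 1000) :
    IsAlmostUniform q (99 / 100) (101 / 100) (gaussianSigns A) := by
  intro K s hK
  have hcard : (K.card : ℝ≥0) ≤ q := by exact_mod_cast hK
  have hδK : K.card ^ 2 * δ ≤ 1 / 1000 := le_trans (by gcongr) hδ
  obtain ⟨hu, hl⟩ := map_restrict_mulVec_gaussianPi_le_and_le hA K hδK
  let cube : Set (K → ℝ) := signBits ⁻¹' subcube (K.subtype (· ∈ K)) (K.restrict s)
  have hcube : MeasurableSet cube := measurable_signBits (measurableSet_subcube _ _)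
  have hmarginal : (gaussianPi X 1).map (fun v => K.restrict (A *ᵥ v)) cube =
      gaussianSigns A (subcube K s) := by
    rw [Measure.map_apply (by fun_prop) hcube,
      preimage_restrict_signBits_preimage_subcube subset_rfl, gaussianSigns,
      Measure.map_apply (by fun_prop) (measurableSet_subcube K s)]
    rfl
  have hlt : K.card * δ < 1 := (mul_le_of_sq_mul_le hδK).trans_lt (by norm_num)
  replace hu := hu cube
  replace hl := hl cube
  simp only [Measure.smul_apply, ENNReal.smul_def, smul_eq_mul] at hu hl
  rw [hmarginal, gaussianPi_signBits_preimage_subcube (by positivity),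
    card_subtype_mem_of_subset subset_rfl] at hu
  rw [hmarginal, gaussianPi_signBits_preimage_subcube (tsub_pos_of_lt hlt).ne',
    card_subtype_mem_of_subset subset_rfl] at hl
  refine ⟨?_, hu⟩
  calc ((99 / 100 : ℝ≥0) : ℝ≥0∞) * 2⁻¹ ^ K.card
      ≤ (99 / 100 : ℝ≥0) * ((101 / 100 : ℝ≥0) * gaussianSigns A (subcube K s)) := by gcongr
    _ ≤ gaussianSigns A (subcube K s) := by
      rw [← mul_assoc, ← ENNReal.coe_mul]
      refine mul_le_of_le_one_left zero_le ?_
      rw [ENNReal.coe_le_one_iff, ← NNReal.coe_le_coe]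
      norm_num

theorem setLIntegral_apply_mul_apply_le (hA : ∀ a b, |(A * Aᵀ - (1 : Matrix ι ι ℝ)) a b| ≤ δ)
    {f : ℝ → ℝ≥0∞} (hf : Measurable f) (hev : f.Even) {m M : ℝ≥0∞}
    (hm : ∀ v : ℝ≥0, 1 ≤ v → v ≤ 101 / 100 → ∫⁻ t, f t ∂gaussianReal 0 v ≤ m)
    (hM : ∀ v : ℝ≥0, v ≤ 101 / 100 → ∫⁻ t, f t ^ 2 ∂gaussianReal 0 v ≤ M)
    (K : Finset ι) (s : ι → Bool) (hδ : (K.card + 2) ^ 2 * δ ≤ 1 / 1000) (i j : ι) :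
    ∫⁻ v in {v | signBits (A *ᵥ v) ∈ subcube K s}, f ((A *ᵥ v) i) * f ((A *ᵥ v) j)
        ∂gaussianPi X 1 ≤
      (101 / 100 : ℝ≥0) * (2⁻¹ ^ K.card * if i = j then M else m ^ 2) := by
  let K' := insert i (insert j K)
  have hi : i ∈ K' := by simp [K']
  have hj : j ∈ K' := by simp [K']
  have hKK' : K ⊆ K' := (Finset.subset_insert j K).trans (Finset.subset_insert i _)
  have hcard : (K'.card : ℝ≥0) ≤ K.card + 2 := by
    exact_mod_cast (Finset.card_insert_le i _).trans (by grind [Finset.card_insert_le])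
  have hδK' : K'.card ^ 2 * δ ≤ 1 / 1000 := le_trans (by gcongr) hδ
  have hv : 1 + K'.card * δ ≤ 101 / 100 := by
    grw [mul_le_of_sq_mul_le hδK', ← NNReal.coe_le_coe]
    norm_num
  let cube : Set (K' → ℝ) := signBits ⁻¹' subcube (K.subtype (· ∈ K')) (K'.restrict s)
  have hcube : MeasurableSet cube := measurable_signBits (measurableSet_subcube _ _)
  calc ∫⁻ v in {v | signBits (A *ᵥ v) ∈ subcube K s}, f ((A *ᵥ v) i) * f ((A *ᵥ v) j)
        ∂gaussianPi X 1
      = ∫⁻ z in cube, f (z ⟨i, hi⟩) * f (z ⟨j, hj⟩)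
          ∂(gaussianPi X 1).map fun v => K'.restrict (A *ᵥ v) := by
        rw [setLIntegral_map hcube (by fun_prop) (by fun_prop),
          preimage_restrict_signBits_preimage_subcube hKK']
        rfl
    _ ≤ ∫⁻ z in cube, f (z ⟨i, hi⟩) * f (z ⟨j, hj⟩)
          ∂((101 / 100 : ℝ≥0) • gaussianPi K' (1 + K'.card * δ)) :=
        lintegral_mono' (Measure.restrict_mono subset_rfl
          (map_restrict_mulVec_gaussianPi_le_and_le hA K' hδK').1) le_rfl
    _ = (101 / 100 : ℝ≥0) * ∫⁻ z in cube, f (z ⟨i, hi⟩) * f (z ⟨j, hj⟩)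
          ∂gaussianPi K' (1 + K'.card * δ) := by
        rw [Measure.restrict_smul, lintegral_smul_measure, ENNReal.smul_def, smul_eq_mul]
    _ ≤ (101 / 100 : ℝ≥0) * (2⁻¹ ^ K.card * if i = j then M else m ^ 2) := by
        rw [setLIntegral_signBits_preimage_subcube_mul (by positivity) _ _ hf hev,
          card_subtype_mem_of_subset hKK']
        simp only [Subtype.mk.injEq]
        gcongr
        split_ifs
        · exact hM _ hv
        · gcongr
          exact hm _ le_self_add hv

theorem setLIntegral_sum_sq_le [Fintype ι]
    (hA : ∀ a b, |(A * Aᵀ - (1 : Matrix ι ι ℝ)) a b| ≤ δ)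
    {f : ℝ → ℝ≥0∞} (hf : Measurable f) (hev : f.Even) {m M : ℝ≥0∞}
    (hm : ∀ v : ℝ≥0, 1 ≤ v → v ≤ 101 / 100 → ∫⁻ t, f t ∂gaussianReal 0 v ≤ m)
    (hM : ∀ v : ℝ≥0, v ≤ 101 / 100 → ∫⁻ t, f t ^ 2 ∂gaussianReal 0 v ≤ M)
    (K : Finset ι) (s : ι → Bool) (hδ : (K.card + 2) ^ 2 * δ ≤ 1 / 1000) :
    ∫⁻ v in {v | signBits (A *ᵥ v) ∈ subcube K s}, (∑ a, f ((A *ᵥ v) a)) ^ 2 ∂gaussianPi X 1 ≤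
      (101 / 100 : ℝ≥0) *
        (2⁻¹ ^ K.card * ((Fintype.card ι * m) ^ 2 + Fintype.card ι * M)) :=
  calc ∫⁻ v in {v | signBits (A *ᵥ v) ∈ subcube K s}, (∑ a, f ((A *ᵥ v) a)) ^ 2 ∂gaussianPi X 1
      = ∑ i, ∑ j, ∫⁻ v in {v | signBits (A *ᵥ v) ∈ subcube K s},
          f ((A *ᵥ v) i) * f ((A *ᵥ v) j) ∂gaussianPi X 1 := by
        simp only [sq, Finset.sum_mul_sum]
        rw [lintegral_finsetSum _ fun i _ => by fun_prop]
        exact Finset.sum_congr rfl fun i _ => lintegral_finsetSum _ fun j _ => by fun_prop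
    _ ≤ ∑ i : ι, ∑ j : ι,
          (101 / 100 : ℝ≥0) * (2⁻¹ ^ K.card * (m ^ 2 + if i = j then M else 0)) := by
        gcongr with i _ j _
        refine (setLIntegral_apply_mul_apply_le hA hf hev hm hM K s hδ i j).trans ?_
        gcongr
        split_ifs <;> simp
    _ = (101 / 100 : ℝ≥0) *
          (2⁻¹ ^ K.card * ((Fintype.card ι * m) ^ 2 + Fintype.card ι * M)) := by
        simp only [← Finset.mul_sum, Finset.sum_add_distrib, Finset.sum_ite_eq, Finset.mem_univ,
          if_true, Finset.sum_const, Finset.card_univ, nsmul_eq_mul]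
        ring

end RoundedGaussian

section RoundedGaussianForrelation

variable {X : Type*} [Fintype X] [DecidableEq X] {H : Matrix X X ℝ} {δ : ℝ≥0}

theorem abs_forrelationForms_mul_transpose_sub_one_le (hH : Hᵀ * H = 1)
    (hHδ : ∀ x y, |H x y| ≤ δ) (a b : X ⊕ X) :
    |(forrelationForms H * (forrelationForms H)ᵀ - (1 : Matrix (X ⊕ X) (X ⊕ X) ℝ)) a b| ≤ δ := by
  rw [forrelationForms, transpose_fromRows, fromRows_mul_fromCols, ← fromBlocks_one,
    Matrix.sub_apply]
  rcases a with a | a <;> rcases b with b | b <;> simp [hH, hHδ]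

theorem card_le_sum_ofReal_signLoss (hH : Hᵀ * H = 1) {v : X → ℝ}
    (hv : matrixForrelation H (signBits (forrelationForms H *ᵥ v)) < 7 / 100) :
    ((93 / 100 * Fintype.card X : ℝ≥0) : ℝ≥0∞) ≤
      ∑ a, ENNReal.ofReal (signLoss ((forrelationForms H *ᵥ v) a)) := by
  rw [← ENNReal.ofReal_sum_of_nonneg fun a _ => signLoss_nonneg _,
    ENNReal.le_ofReal_iff_toReal_le ENNReal.coe_ne_top
      (Finset.sum_nonneg fun a _ => signLoss_nonneg _)]
  refine le_trans ?_ (card_mul_one_sub_matrixForrelation_le_sum_signLoss hH v)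
  rw [ENNReal.coe_toReal, mul_comm, NNReal.coe_mul, NNReal.coe_natCast]
  refine mul_le_mul_of_nonneg_left ?_ (Nat.cast_nonneg _)
  push_cast
  linarith

theorem setLIntegral_sum_signLoss_sq_le (hH : Hᵀ * H = 1) (hHδ : ∀ x y, |H x y| ≤ δ)
    (hX : 10 ^ 5 ≤ Fintype.card X) (K : Finset (X ⊕ X)) (s : X ⊕ X → Bool)
    (hδ : (K.card + 2) ^ 2 * δ ≤ 1 / 1000) :
    ∫⁻ v in {v | signBits (forrelationForms H *ᵥ v) ∈ subcube K s},
        (∑ a, ENNReal.ofReal (signLoss ((forrelationForms H *ᵥ v) a))) ^ 2 ∂gaussianPi X 1 ≤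
      ((93 / 100 * Fintype.card X) ^ 2 * (69 / 100) : ℝ≥0) * 2⁻¹ ^ K.card := by
  set N := Fintype.card X
  have hN : (10 ^ 5 : ℝ) ≤ N := by exact_mod_cast hX
  have hconstants : 101 / 100 * ((2 * N * (153 / 400)) ^ 2 + 2 * N * 200) ≤
      (93 / 100 * N) ^ 2 * (69 / 100 : ℝ≥0) := by
    rw [← NNReal.coe_le_coe]
    push_cast
    nlinarith
  calc _ ≤ _ := setLIntegral_sum_sq_le (abs_forrelationForms_mul_transpose_sub_one_le hH hHδ)
        (by fun_prop) (fun t => by rw [signLoss_neg]) (fun v => lintegral_signLoss_le)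
        (fun v => lintegral_signLoss_sq_le) K s hδ
    _ = ((101 / 100 * ((2 * N * (153 / 400)) ^ 2 + 2 * N * 200) : ℝ≥0) : ℝ≥0∞) *
          2⁻¹ ^ K.card := by
        rw [Fintype.card_sum]
        push_cast
        ring
    _ ≤ ((93 / 100 * N) ^ 2 * (69 / 100) : ℝ≥0) * 2⁻¹ ^ K.card := by gcongr

theorem gaussianSigns_subcube_sdiff_le (hH : Hᵀ * H = 1) (hHδ : ∀ x y, |H x y| ≤ δ)
    (hX : 10 ^ 5 ≤ Fintype.card X) (K : Finset (X ⊕ X)) (s : X ⊕ X → Bool)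
    (hδ : (K.card + 2) ^ 2 * δ ≤ 1 / 1000) :
    gaussianSigns (forrelationForms H) (subcube K s \ {z | 7 / 100 ≤ matrixForrelation H z}) ≤
      (69 / 100 : ℝ≥0) * 2⁻¹ ^ K.card := by
  set A := forrelationForms H
  let C : Set (X → ℝ) := {v | signBits (A *ᵥ v) ∈ subcube K s}
  let loss (v : X → ℝ) : ℝ≥0∞ := ∑ a, ENNReal.ofReal (signLoss ((A *ᵥ v) a))
  let r : ℝ≥0 := 93 / 100 * Fintype.card X
  have : r ≠ 0 := by positivity
  have hsigns : Measurable fun v => signBits (A *ᵥ v) := by fun_prop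
  have hC : MeasurableSet C := hsigns (measurableSet_subcube K s)
  have hbad : gaussianSigns A (subcube K s \ {z | 7 / 100 ≤ matrixForrelation H z}) ≤
      (gaussianPi X 1).restrict C {v | (r : ℝ≥0∞) ^ 2 ≤ loss v ^ 2} := by
    rw [gaussianSigns, Measure.map_apply hsigns (Set.toFinite _).measurableSet,
      Measure.restrict_apply' hC]
    refine measure_mono fun v hv => ⟨?_, hv.1⟩
    have := card_le_sum_ofReal_signLoss hH (not_le.1 hv.2)
    exact pow_le_pow_left' this 2
  have hmoment : ∫⁻ v in C, loss v ^ 2 ∂gaussianPi X 1 ≤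
      r ^ 2 * ((69 / 100 : ℝ≥0) * 2⁻¹ ^ K.card) :=
    (setLIntegral_sum_signLoss_sq_le hH hHδ hX K s hδ).trans_eq (by
      rw [ENNReal.coe_mul, ENNReal.coe_pow, mul_assoc])
  have hmarkov := mul_meas_ge_le_lintegral (μ := (gaussianPi X 1).restrict C)
    (f := fun v => loss v ^ 2) (by fun_prop) ((r : ℝ≥0∞) ^ 2)
  refine hbad.trans ((ENNReal.mul_le_mul_iff_right (a := (r : ℝ≥0∞) ^ 2) ?_ ?_).1
    (hmarkov.trans hmoment))
  · positivity
  · finiteness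

theorem isAlmostUniform_gaussianSigns_restrict (hH : Hᵀ * H = 1) (hHδ : ∀ x y, |H x y| ≤ δ)
    (hX : 10 ^ 5 ≤ Fintype.card X) {q : ℕ} (hδ : (q + 2) ^ 2 * δ ≤ 1 / 1000) :
    IsAlmostUniform q (3 / 10) (101 / 100)
      ((gaussianSigns (forrelationForms H)).restrict {z | 7 / 100 ≤ matrixForrelation H z}) := by
  have hq : (q ^ 2 * δ : ℝ≥0) ≤ 1 / 1000 := le_trans (by gcongr; simp) hδ
  rw [show (3 / 10 : ℝ≥0) = 99 / 100 - 69 / 100 from (tsub_eq_of_eq_add (by norm_num)).symm]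
  refine (isAlmostUniform_gaussianSigns
    (abs_forrelationForms_mul_transpose_sub_one_le hH hHδ) hq).restrict
    (Set.toFinite _).measurableSet fun K s hK => gaussianSigns_subcube_sdiff_le hH hHδ hX K s
      (le_trans ?_ hδ)
  gcongr

end RoundedGaussianForrelation

theorem eventually_eval_le_two_pow (p : Polynomial ℕ) :
    ∀ᶠ n : ℕ in Filter.atTop, p.eval n ≤ 2 ^ n := by
  have h : (fun n : ℕ => ((p.eval n : ℕ) : ℝ)) =o[Filter.atTop] fun n => (2 : ℝ) ^ n := by
    simp only [Polynomial.eval_eq_sum_range, Nat.cast_sum, Nat.cast_mul, Nat.cast_pow]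
    refine Asymptotics.IsLittleO.fun_sum fun k _ => ?_
    exact (isLittleO_pow_const_const_pow_of_one_lt k one_lt_two).const_mul_left _
  filter_upwards [h.bound one_pos] with n hn
  rw [one_mul, Real.norm_natCast, norm_pow, Real.norm_ofNat] at hn
  exact_mod_cast hn

theorem sq_mul_inv_sqrt_two_pow_le {n k : ℕ} (h : 10 ^ 6 * k ^ 4 ≤ 2 ^ n) :
    (k ^ 2 * (NNReal.sqrt (2 ^ n))⁻¹ : ℝ≥0) ≤ 1 / 1000 := by
  have hsqrt : (1000 * k ^ 2 : ℝ≥0) ≤ NNReal.sqrt (2 ^ n) := by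
    rw [NNReal.le_sqrt_iff_sq_le]
    calc (1000 * k ^ 2 : ℝ≥0) ^ 2 = 10 ^ 6 * k ^ 4 := by ring
      _ ≤ 2 ^ n := by exact_mod_cast h
  rwa [← div_eq_mul_inv, div_le_div_iff₀ (by positivity) (by positivity), one_mul, mul_comm]

theorem mainTheorem2_general {n q : ℕ} (h : 10 ^ 6 * (q + 2) ^ 4 ≤ 2 ^ n) :
    ¬ ∃ A : BPPPathAlgorithm (ForIndex n), A.MakesAtMost q ∧ A.Computes (For n) := by
  rintro ⟨A, hA, hAF⟩
  let H := hadamardMatrix n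
  have horthogonal : Hᵀ * H = 1 := by rw [hadamardMatrix_transpose, hadamardMatrix_mul_self]
  have hentry (x y) : |H x y| ≤ (NNReal.sqrt (2 ^ n))⁻¹ := by
    simpa using (abs_hadamardMatrix x y).le
  have hcard : Fintype.card (Fin n → Bool) = 2 ^ n := by simp
  have hlarge : 10 ^ 6 * (q + 2) ≤ 2 ^ n :=
    le_trans (by gcongr; exact Nat.le_self_pow (by simp) _) h
  have hchebyshev : (q + 1 : ℝ≥0) ≤ 1 / 100 * (1 / 100) ^ 2 * Fintype.card (Fin n → Bool) := by
    have : (10 ^ 6 * (q + 2) : ℝ) ≤ 2 ^ n := by exact_mod_cast hlarge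
    rw [hcard, ← NNReal.coe_le_coe]
    push_cast
    linarith
  have huniform := isAlmostUniform_uniformOn_restrict horthogonal hchebyshev
  have hgaussian := isAlmostUniform_gaussianSigns_restrict horthogonal hentry (q := q)
    (by rw [hcard]; omega) (by exact_mod_cast sq_mul_inv_sqrt_two_pow_le h)
  refine BPPPathAlgorithm.not_computes_of_isAlmostUniform hA ?_ ?_ huniform hgaussian ?_ hAF
  · filter_upwards [ae_restrict_mem (Set.toFinite _).measurableSet] with z hz
    exact For_eq_some_false (by simpa using hz)
  · filter_upwards [ae_restrict_mem (Set.toFinite _).measurableSet] with z hz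
    exact For_eq_some_true hz
  · rw [← NNReal.coe_lt_coe, NNReal.coe_mul, NNReal.coe_mul, NNReal.coe_mul, NNReal.coe_sub]
    all_goals norm_num [← NNReal.coe_le_coe]

theorem mainTheorem2 (p : Polynomial ℕ) :
    ∀ᶠ n : ℕ in Filter.atTop,
      ¬ ∃ A : BPPPathAlgorithm (ForIndex n), A.MakesAtMost (p.eval n) ∧ A.Computes (For n) :=
  (eventually_eval_le_two_pow (10 ^ 6 * (p + 2) ^ 4)).mono fun _ h =>
    mainTheorem2_general (by simpa using h)
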